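/- \textbf{Optimal execution strategy for a displaced diffusion.} Let $\sigma>0$, $T>0$ and $S_0,K,X,L,\check\lambda\in\mathbb{R}$. Let $S=(S_t)_{t\ge 0}$ be a displaced diffusion, i.e. $Y_t=S_t-K$ is a driftless geometric Brownian motion with volatility $\sigma$ and initial level $Y_0=S_0-K$: $dY_t=\sigma Y_t\,dW_t$, that is, almost surely $Y_t=(S_0-K)\exp(\sigma W_t-\tfrac12\sigma^2t)$ for all $t\ge 0$, with $W$ a standard Brownian motion. Call a process $x=(x(t))_{0\le t\le T}$ an admissible strategy if it is adapted to the ($\mathbb{P}$-completed) filtration generated by $S$, almost surely has absolutely continuous paths on $[0,T]$, and satisfies $x(0)=X$ and $x(T)=0$ almost surely. For admissible $x$ set $$J(x)=\mathbb{E}\left[\int_0^T\dot x(t)^2\,dt+L\check\lambda\int_0^T x(t)(S_t-K)\,dt\right]\in(-\infty,\infty].$$ Then the strategy $$x^*_t=\frac{T-t}{T}\left[X-L\check\lambda\,\frac{T}{4}\int_0^t(S_u-K)\,du\right],\qquad 0\le t\le T,$$ is admissible and minimises $J$ over all admissible strategies. It is the unique minimiser: if an admissible $x$ attains the infimum of $J$,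 then almost surely $x(t)=x^*_t$ for all $t\in[0,T]$. Moreover, the optimal value is $$J(x^*)=\frac{X^2}{T}+\frac{L\check\lambda\,T X(S_0-K)}{2}-\frac{(L\check\lambda)^2}{8\sigma^6}(S_0-K)^2\left(e^{\sigma^2T}-1-\sigma^2T-\frac{\sigma^4T^2}{2}\right).$$ -/

import Mathlib

open MeasureTheory ProbabilityTheory
open scoped NNReal ENNReal

noncomputable section

/-- `Y` is, under `P`, a (driftless) geometric Brownian motion with volatility `σ` and initial
level `y₀`, that is, the solution `Y_t = y₀ exp (σ W_t - σ² t / 2)` of `dY_t = σ Y_t dW_t`,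
`Y_0 = y₀`, for a standard Brownian motion `W`. -/
def IsGeometricBrownian {Ω : Type*} [MeasurableSpace Ω] (Y : ℝ≥0 → Ω → ℝ) (σ y₀ : ℝ)
    (P : Measure Ω) : Prop :=
  ∃ W : ℝ≥0 → Ω → ℝ, IsBrownianReal W P ∧
    ∀ᵐ ω ∂P, ∀ t : ℝ≥0, Y t ω = y₀ * Real.exp (σ * W t ω - σ ^ 2 * (t : ℝ) / 2)

/-- `S` is a displaced diffusion with shift `K`, volatility `σ` and initial value `S₀`:
`S - K` is a geometric Brownian motion with volatility `σ` and initial level `S₀ - K`. -/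
def IsDisplacedDiffusion {Ω : Type*} [MeasurableSpace Ω] (S : ℝ≥0 → Ω → ℝ) (σ K S₀ : ℝ)
    (P : Measure Ω) : Prop :=
  IsGeometricBrownian (fun t ω => S t ω - K) σ (S₀ - K) P

/-- Execution strategies on `[0, T]` that start at `X` and end at `0`, are absolutely continuous
in time and adapted to the filtration `𝓕`. As usual everything is understood up to `P`-null sets:
`x t` is `P`-a.e. equal to an `𝓕 t`-measurable function, which is measurability with respect to
the completion of `𝓕 t`. No integrability is imposed. -/
structure IsAdmissibleStrategy {Ω : Type*} [mΩ : MeasurableSpace Ω] (P : Measure Ω)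
    (𝓕 : Filtration ℝ≥0 mΩ) (T X : ℝ) (x : ℝ → Ω → ℝ) : Prop where
  adapted : ∀ t : ℝ≥0, (t : ℝ) ≤ T → AEStronglyMeasurable[𝓕 t] (x t) P
  absolutelyContinuous : ∀ᵐ ω ∂P, AbsolutelyContinuousOnInterval (fun t => x t ω) 0 T
  initial : ∀ᵐ ω ∂P, x 0 ω = X
  terminal : ∀ᵐ ω ∂P, x T ω = 0

/-- The expectation `E[f⁺] - E[f⁻]` of an extended real random variable. Only `∞ - ∞` is
a junk case; its value is then `⊥`. -/
def extendedExpectation {Ω : Type*} [MeasurableSpace Ω] (P : Measure Ω) (f : Ω → EReal) : EReal :=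
  ((∫⁻ ω, (f ω).toENNReal ∂P : ℝ≥0∞) : EReal) - ((∫⁻ ω, (-f ω).toENNReal ∂P : ℝ≥0∞) : EReal)

/-- The cost `∫₀ᵀ ẋ(t)² dt + c ∫₀ᵀ x(t) (S_t - K) dt` along the path `ω`. It takes the value `⊤`
when the derivative of the path is not square integrable. -/
def pathCost {Ω : Type*} (S : ℝ≥0 → Ω → ℝ) (K T c : ℝ) (x : ℝ → Ω → ℝ) (ω : Ω) : EReal :=
  ((∫⁻ t in Set.Icc 0 T, ENNReal.ofReal (deriv (fun s => x s ω) t ^ 2) : ℝ≥0∞) : EReal) +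
    ((c * ∫ t in (0 : ℝ)..T, x t ω * (S t.toNNReal ω - K) : ℝ) : EReal)

/-- The criterion `E[∫₀ᵀ ẋ(t)² dt + c ∫₀ᵀ x(t) (S_t - K) dt]`, with values in `[-∞, ∞]`. -/
def executionCriterion {Ω : Type*} [MeasurableSpace Ω] (P : Measure Ω) (S : ℝ≥0 → Ω → ℝ)
    (K T c : ℝ) (x : ℝ → Ω → ℝ) : EReal :=
  extendedExpectation P (pathCost S K T c x)

/-- The strategy `x*_t = ((T - t) / T) (X - c (T / 4) ∫₀ᵗ (S_u - K) du)`. -/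
def optimalStrategy {Ω : Type*} (S : ℝ≥0 → Ω → ℝ) (K T X c : ℝ) (t : ℝ) (ω : Ω) : ℝ :=
  (T - t) / T * (X - c * (T / 4) * ∫ u in (0 : ℝ)..t, (S u.toNNReal ω - K))

end

/-!
Let `Y = S - K`, `c = L * lam` and `I t = ∫₀ᵗ Y u du`. An admissible strategy `x` with rate `v = ẋ`
vanishes at time `T`, so integrating `c ∫ x Y` by parts turns its cost into `∫ (v² - c I v) dt`,
where `v` is adapted and integrates to `-X` over `[0, T]`. This is a convex quadratic functional
of `v`.

The proposed rate is `v* = -X / T + (c / 4) (I - (T - t) Y)`. With `w = v - v*`,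
`v² - c I v = v*² - c I v* + w² + w (2 v* - c I)`, and `2 v* - c I = -2 X / T - (c / 2) N` with
`N t = I t + (T - t) Y t`. Since `Y` is a martingale, `N t = E[I T | 𝓕 t]`. As `w t` is measurable
with respect to the past of `t`, `E[w t * N t] = E[w t * I T]`; integrating in time and using
`∫ w = 0` shows that the linear term has zero expectation
(`IsL2Martingale.integral_mul_closing_eq_zero`). Hence
`cost v = cost v* + E ∫ (v - v*)²` (`IsL2Martingale.rateCost_eq_add`), which gives both optimality
and uniqueness. Applied to the constant rate `-X / T`, the same identity yields the optimal value:
`E ∫ (I - (T - t) Y)² = ∫ (T - t)² E[Y t²] dt`, because the difference of the integrands is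
pathwise the derivative of `-(T - t) I²`.

A strategy whose rate is not square integrable on `[0, T] × Ω` has criterion `⊤`, since the linear
term is bounded by half of `∫ v²` plus an integrable variable
(`IsAdmissibleStrategy.executionCriterion_eq_top`).

Two measurability points need care. Strategies are only adapted up to null sets at each fixed time;
continuity of the paths provides jointly measurable versions
(`exists_jointly_measurable_version`), and limits of left difference quotients provide an adapted
version of the rate (`exists_measurable_adapted_deriv`). The filtration is the one of `S`, while
independence of increments is known for the driving Brownian motion; it is transferred through
the almost sure identity defining `S` (`indepFun_natural_increment`).
-/

/-! ### Jointly measurable versions of processes with continuous paths -/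

/-- The value at time `t` only uses the entries `y n k` with `k = ⌊(n + 1) t⌋`, a countable family;
this is what makes the limit jointly measurable. -/
lemma measurable_uncurry_limsup_floor {Ω : Type*} [MeasurableSpace Ω] (y : ℕ → ℕ → Ω → ℝ)
    (hy : ∀ n k, Measurable (y n k)) :
    Measurable (Function.uncurry fun (t : ℝ) (ω : Ω) =>
      Filter.limsup (fun n : ℕ => y n ⌊((n : ℝ) + 1) * t⌋₊ ω) Filter.atTop) := by
  refine Measurable.limsup fun n => ?_
  have h : Measurable fun q : ℕ × Ω => y n q.1 q.2 := measurable_from_prod_countable_right (hy n)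
  have h2 : Measurable fun p : ℝ × Ω => (⌊((n : ℝ) + 1) * p.1⌋₊, p.2) := by fun_prop
  exact h.comp h2

lemma floor_div_mem_Icc {T t : ℝ} (ht : t ∈ Set.Icc 0 T) (n : ℕ) :
    (⌊((n : ℝ) + 1) * t⌋₊ : ℝ) / (n + 1) ∈ Set.Icc 0 T := by
  refine ⟨by positivity, ?_⟩
  rw [div_le_iff₀ (by positivity)]
  have := Nat.floor_le (a := ((n : ℝ) + 1) * t) (by have := ht.1; positivity)
  nlinarith [ht.2]

lemma tendsto_floor_div {t : ℝ} (ht : 0 ≤ t) :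
    Filter.Tendsto (fun n : ℕ => (⌊((n : ℝ) + 1) * t⌋₊ : ℝ) / (n + 1)) Filter.atTop (nhds t) := by
  have h := (tendsto_nat_floor_mul_div_atTop ht).comp
    (Filter.tendsto_atTop_add_const_right Filter.atTop (1 : ℝ) tendsto_natCast_atTop_atTop)
  refine h.congr fun n => ?_
  simp [mul_comm]

/-- A process with continuous paths on `[0, T]` whose values are `m`-measurable up to null sets is
indistinguishable on `[0, T]` from a process measurable for the product of the Borel σ-algebra and
`m`. The σ-algebra `m` may be smaller than the ambient one, so that applying this on `[0, t]` to the
past of `t` yields progressive measurability. -/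
lemma exists_jointly_measurable_version {Ω : Type*} (m : MeasurableSpace Ω)
    {mΩ : MeasurableSpace Ω} {P : Measure Ω} {T : ℝ} {z : ℝ → Ω → ℝ}
    (hz : ∀ t ∈ Set.Icc 0 T, AEStronglyMeasurable[m] (z t) P)
    (hc : ∀ᵐ ω ∂P, ContinuousOn (fun t => z t ω) (Set.Icc 0 T)) :
    ∃ z' : ℝ → Ω → ℝ,
      @Measurable (ℝ × Ω) ℝ (@Prod.instMeasurableSpace ℝ Ω _ m) _ (Function.uncurry z') ∧
      ∀ᵐ ω ∂P, ∀ t ∈ Set.Icc 0 T, z' t ω = z t ω := by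
  classical
  -- `y n k` is an `m`-measurable version of `z` at the grid point `k / (n + 1)`.
  have key : ∀ n k : ℕ, ∃ y : Ω → ℝ, Measurable[m] y ∧
      ((k : ℝ) / (n + 1) ∈ Set.Icc 0 T → z ((k : ℝ) / (n + 1)) =ᵐ[P] y) := by
    intro n k
    by_cases h : (k : ℝ) / (n + 1) ∈ Set.Icc 0 T
    · exact ⟨(hz _ h).mk _, (hz _ h).stronglyMeasurable_mk.measurable, fun _ => (hz _ h).ae_eq_mk⟩
    · exact ⟨fun _ => 0, @measurable_const _ _ _ m _, fun h' => absurd h' h⟩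
  choose y hy hyz using key
  refine ⟨fun t ω => Filter.limsup (fun n : ℕ => y n ⌊((n : ℝ) + 1) * t⌋₊ ω) Filter.atTop,
    @measurable_uncurry_limsup_floor Ω m y hy, ?_⟩
  have hall : ∀ᵐ ω ∂P, ∀ n k : ℕ, (k : ℝ) / (n + 1) ∈ Set.Icc 0 T →
      z ((k : ℝ) / (n + 1)) ω = y n k ω := by
    rw [ae_all_iff]; intro n
    rw [ae_all_iff]; intro k
    by_cases h : (k : ℝ) / (n + 1) ∈ Set.Icc 0 T
    · filter_upwards [hyz n k h] with ω hω _ using hω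
    · exact ae_of_all _ fun ω h' => absurd h' h
  filter_upwards [hall, hc] with ω hω hcω t ht
  refine Filter.Tendsto.limsup_eq ?_
  have h1 : Filter.Tendsto (fun n : ℕ => (⌊((n : ℝ) + 1) * t⌋₊ : ℝ) / (n + 1)) Filter.atTop
      (nhdsWithin t (Set.Icc 0 T)) :=
    tendsto_nhdsWithin_iff.2 ⟨tendsto_floor_div ht.1,
      Filter.Eventually.of_forall fun n => floor_div_mem_Icc ht n⟩
  refine ((hcω t ht).tendsto.comp h1).congr fun n => ?_
  exact hω n _ (floor_div_mem_Icc ht n)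

lemma aestronglyMeasurable_limsup {Ω : Type*} {m : MeasurableSpace Ω}
    {mΩ : MeasurableSpace Ω} {P : Measure Ω} {f : ℕ → Ω → ℝ}
    (hf : ∀ n, AEStronglyMeasurable[m] (f n) P) :
    AEStronglyMeasurable[m] (fun ω => Filter.limsup (fun n => f n ω) Filter.atTop) P := by
  refine ⟨fun ω => Filter.limsup (fun n => (hf n).mk _ ω) Filter.atTop, ?_, ?_⟩
  · have h : ∀ n, Measurable[m] ((hf n).mk _) := fun n => (hf n).stronglyMeasurable_mk.measurable
    exact (Measurable.limsup h).stronglyMeasurable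
  · filter_upwards [ae_all_iff.2 fun n => (hf n).ae_eq_mk] with ω hω
    simp_rw [hω]

/-- The left difference quotient recovers the derivative using only the past of the function. -/
lemma tendsto_left_difference_quotient {f : ℝ → ℝ} {t : ℝ} (hf : DifferentiableAt ℝ f t) :
    Filter.Tendsto (fun n : ℕ => ((n : ℝ) + 1) * (f t - f (t - 1 / ((n : ℝ) + 1))))
      Filter.atTop (nhds (deriv f t)) := by
  have h := hasDerivAt_iff_tendsto_slope.1 hf.hasDerivAt
  have h1 : Filter.Tendsto (fun n : ℕ => t - 1 / ((n : ℝ) + 1)) Filter.atTop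
      (nhdsWithin t {t}ᶜ) := by
    refine tendsto_nhdsWithin_iff.2 ⟨?_, Filter.Eventually.of_forall fun n => ?_⟩
    · simpa using (tendsto_const_nhds (x := t)).sub
        (tendsto_one_div_add_atTop_nhds_zero_nat (𝕜 := ℝ))
    · have : 0 < 1 / ((n : ℝ) + 1) := by positivity
      simp only [Set.mem_compl_iff, Set.mem_singleton_iff]
      linarith
  refine (h.comp h1).congr fun n => ?_
  have : (n : ℝ) + 1 ≠ 0 := by positivity
  simp only [Function.comp, slope_def_field]
  field_simp
  ring

/-- The time derivative of an adapted process with absolutely continuous paths has a jointly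
measurable and adapted version. -/
lemma exists_measurable_adapted_deriv {Ω : Type*} {mΩ : MeasurableSpace Ω} {P : Measure Ω}
    {𝓕 : Filtration ℝ≥0 mΩ} {T : ℝ} {x : ℝ → Ω → ℝ}
    (had : ∀ t ∈ Set.Icc 0 T, AEStronglyMeasurable[𝓕 t.toNNReal] (x t) P)
    (hac : ∀ᵐ ω ∂P, AbsolutelyContinuousOnInterval (fun t => x t ω) 0 T) (hT : 0 ≤ T) :
    ∃ v : ℝ → Ω → ℝ, Measurable (Function.uncurry v) ∧
      (∀ t ∈ Set.Ioc 0 T, AEStronglyMeasurable[𝓕 t.toNNReal] (v t) P) ∧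
      ∀ᵐ ω ∂P, ∀ᵐ t ∂(volume.restrict (Set.Ioc 0 T)), v t ω = deriv (fun s => x s ω) t := by
  classical
  obtain ⟨x', hx', hxx'⟩ := exists_jointly_measurable_version (T := T) (z := x) mΩ
    (fun t ht => (had t ht).mono (𝓕.le _))
    (hac.mono fun ω h => by simpa [Set.uIcc_of_le hT] using h.continuousOn)
  -- Quotients reaching before time `0` are cut off, so as to remain adapted.
  let q : ℕ → ℝ → Ω → ℝ := fun n t ω =>
    if 1 / ((n : ℝ) + 1) ≤ t then ((n : ℝ) + 1) * (x' t ω - x' (t - 1 / ((n : ℝ) + 1)) ω) else 0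
  refine ⟨fun t ω => Filter.limsup (fun n => q n t ω) Filter.atTop, ?_, ?_, ?_⟩
  · refine Measurable.limsup fun n => ?_
    refine Measurable.ite (measurableSet_le measurable_const measurable_fst) ?_ measurable_const
    have h1 : Measurable fun p : ℝ × Ω => x' p.1 p.2 := hx'
    have h2 : Measurable fun p : ℝ × Ω => x' (p.1 - 1 / ((n : ℝ) + 1)) p.2 :=
      hx'.comp ((measurable_fst.sub_const _).prodMk measurable_snd)
    exact (h1.sub h2).const_mul _
  · intro t ht
    change AEStronglyMeasurable[𝓕 t.toNNReal]
      (fun ω => Filter.limsup (fun n => q n t ω) Filter.atTop) P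
    refine aestronglyMeasurable_limsup fun n => ?_
    have hmem : ∀ s ∈ Set.Icc 0 t, AEStronglyMeasurable[𝓕 t.toNNReal] (x' s) P := by
      intro s hs
      have hsT : s ∈ Set.Icc 0 T := ⟨hs.1, hs.2.trans ht.2⟩
      have := (had s hsT).mono (𝓕.mono (Real.toNNReal_le_toNNReal hs.2))
      exact this.congr (hxx'.mono fun ω h => (h s hsT).symm)
    by_cases h : 1 / ((n : ℝ) + 1) ≤ t
    · simp only [q, if_pos h]
      have hp : 0 < 1 / ((n : ℝ) + 1) := by positivity
      exact ((hmem t ⟨ht.1.le, le_rfl⟩).sub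
        (hmem _ ⟨by linarith, by linarith⟩)).const_mul _
    · simp only [q, if_neg h]
      exact aestronglyMeasurable_const
  · filter_upwards [hac, hxx'] with ω hω hω'
    rw [ae_restrict_iff' measurableSet_Ioc]
    filter_upwards [hω.ae_differentiableAt] with t ht htT
    have htI : t ∈ Set.Icc 0 T := ⟨htT.1.le, htT.2⟩
    refine Filter.Tendsto.limsup_eq ?_
    refine (tendsto_left_difference_quotient (ht (by rwa [Set.uIcc_of_le hT]))).congr' ?_
    have hev : ∀ᶠ n : ℕ in Filter.atTop, 1 / ((n : ℝ) + 1) < t :=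
      (tendsto_one_div_add_atTop_nhds_zero_nat (𝕜 := ℝ)).eventually_lt_const htT.1
    filter_upwards [hev] with n hn
    have hp : 0 < 1 / ((n : ℝ) + 1) := by positivity
    simp only [q, if_pos hn.le]
    rw [hω' t htI, hω' _ ⟨by linarith, by linarith [htT.2]⟩]

/-! ### Square integrable processes and their time integrals -/

lemma sq_integral_le_measure_mul_integral_sq {α : Type*} [MeasurableSpace α] {μ : Measure α}
    [IsFiniteMeasure μ] {f : α → ℝ} (hf : MemLp f 2 μ) :
    (∫ a, f a ∂μ) ^ 2 ≤ μ.real Set.univ * ∫ a, f a ^ 2 ∂μ := by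
  set V := μ.real Set.univ with hV
  set m := ∫ a, f a ∂μ with hm
  have hf1 : Integrable f μ := hf.integrable one_le_two
  have hf2 : Integrable (fun a => f a ^ 2) μ := hf.integrable_sq
  rcases (measureReal_nonneg (μ := μ) (s := Set.univ)).eq_or_lt with h0 | hpos
  · have hμ : μ = 0 := by
      have := (measureReal_eq_zero_iff (μ := μ) (s := Set.univ)).1 h0.symm
      exact Measure.measure_univ_eq_zero.1 this
    simp [hm, hμ]
  · -- Expanding `0 ≤ ∫ (V f - m)²` gives the Cauchy-Schwarz inequality.
    have h : 0 ≤ ∫ a, (V * f a - m) ^ 2 ∂μ := integral_nonneg fun a => sq_nonneg _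
    have e : ∫ a, (V * f a - m) ^ 2 ∂μ = V ^ 2 * ∫ a, f a ^ 2 ∂μ - 2 * V * m * m + V * m ^ 2 := by
      have : (fun a => (V * f a - m) ^ 2) =
          fun a => V ^ 2 * f a ^ 2 - 2 * V * m * f a + m ^ 2 := by
        funext a; ring
      have hi : Integrable (fun a => V ^ 2 * f a ^ 2 - 2 * V * m * f a) μ :=
        (hf2.const_mul _).sub (hf1.const_mul _)
      rw [this, integral_add hi (integrable_const _),
        integral_sub (hf2.const_mul _) (hf1.const_mul _), integral_const_mul, integral_const_mul,
        integral_const, smul_eq_mul]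
    rw [e] at h
    have : 0 ≤ V * (V * ∫ a, f a ^ 2 ∂μ - m ^ 2) := by nlinarith
    have := nonneg_of_mul_nonneg_right this hpos
    linarith

lemma ae_memLp_two_of_memLp_prod {α β : Type*} [MeasurableSpace α] [MeasurableSpace β]
    {μ : Measure α} {ν : Measure β} [SFinite μ] [SFinite ν] {f : α → β → ℝ}
    (hf : MemLp (Function.uncurry f) 2 (μ.prod ν)) :
    ∀ᵐ a ∂μ, MemLp (f a) 2 ν := by
  filter_upwards [hf.1.prodMk_left, hf.integrable_sq.prod_right_ae] with a h1 h2
  exact (memLp_two_iff_integrable_sq h1).2 h2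

lemma ae_memLp_two_of_memLp_prod_right {α β : Type*} [MeasurableSpace α] [MeasurableSpace β]
    {μ : Measure α} {ν : Measure β} [SFinite μ] [SFinite ν] {f : α → β → ℝ}
    (hf : MemLp (Function.uncurry f) 2 (μ.prod ν)) :
    ∀ᵐ b ∂ν, MemLp (fun a => f a b) 2 μ := by
  filter_upwards [hf.1.prodMk_right, hf.integrable_sq.prod_left_ae] with a h1 h2
  exact (memLp_two_iff_integrable_sq h1).2 h2

/-- The running time integral `∫₀ᵗ Y u du`, for `t ≥ 0`. -/
noncomputable def timeIntegral {Ω : Type*} (Y : ℝ → Ω → ℝ) (t : ℝ) (ω : Ω) : ℝ :=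
  ∫ u in Set.Ioc 0 t, Y u ω

lemma timeIntegral_eq_intervalIntegral {Ω : Type*} (Y : ℝ → Ω → ℝ) {t : ℝ} (ht : 0 ≤ t) (ω : Ω) :
    timeIntegral Y t ω = ∫ u in (0 : ℝ)..t, Y u ω :=
  (intervalIntegral.integral_of_le ht).symm

lemma measurable_timeIntegral_apply {Ω : Type*} [MeasurableSpace Ω] {Y : ℝ → Ω → ℝ}
    (hY : Measurable (Function.uncurry Y)) (t : ℝ) : Measurable (timeIntegral Y t) := by
  have h : StronglyMeasurable fun p : Ω × ℝ => Y p.2 p.1 :=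
    (hY.comp measurable_swap).stronglyMeasurable
  exact h.integral_prod_right'.measurable

lemma measurable_timeIntegral {Ω : Type*} [MeasurableSpace Ω] {Y : ℝ → Ω → ℝ}
    (hY : Measurable (Function.uncurry Y)) : Measurable (Function.uncurry (timeIntegral Y)) := by
  have h : Measurable fun p : (ℝ × Ω) × ℝ =>
      Set.indicator {p : (ℝ × Ω) × ℝ | 0 < p.2 ∧ p.2 ≤ p.1.1} (fun p => Y p.2 p.1.2) p := by
    refine Measurable.indicator ?_ ?_
    · exact hY.comp (measurable_snd.prodMk (measurable_snd.comp measurable_fst))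
    · exact (measurableSet_lt measurable_const measurable_snd).inter
        (measurableSet_le measurable_snd (measurable_fst.comp measurable_fst))
  have h2 := h.stronglyMeasurable.integral_prod_right' (ν := (volume : Measure ℝ))
  convert h2.measurable using 1
  funext p
  simp only [Function.uncurry, timeIntegral]
  rw [← integral_indicator measurableSet_Ioc]
  rfl

lemma sq_timeIntegral_le {Ω : Type*} {Y : ℝ → Ω → ℝ} {T t : ℝ} {ω : Ω} (ht : t ∈ Set.Icc 0 T)
    (hY : MemLp (fun u => Y u ω) 2 (volume.restrict (Set.Ioc 0 T))) :
    timeIntegral Y t ω ^ 2 ≤ T * ∫ u in Set.Ioc 0 T, Y u ω ^ 2 := by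
  have hsub : Set.Ioc 0 t ⊆ Set.Ioc 0 T := Set.Ioc_subset_Ioc_right ht.2
  have h1 := sq_integral_le_measure_mul_integral_sq
    (hY.mono_measure (Measure.restrict_mono hsub le_rfl))
  have h2 : ∫ u in Set.Ioc 0 t, Y u ω ^ 2 ≤ ∫ u in Set.Ioc 0 T, Y u ω ^ 2 :=
    setIntegral_mono_set hY.integrable_sq (ae_of_all _ fun u => sq_nonneg _)
      (Filter.Eventually.of_forall hsub)
  have hv : (volume.restrict (Set.Ioc 0 t)).real Set.univ = t := by
    simp [Measure.real, ht.1]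
  rw [hv] at h1
  have h0 : 0 ≤ ∫ u in Set.Ioc 0 T, Y u ω ^ 2 := integral_nonneg fun u => sq_nonneg _
  calc _ ≤ t * ∫ u in Set.Ioc 0 t, Y u ω ^ 2 := h1
    _ ≤ t * ∫ u in Set.Ioc 0 T, Y u ω ^ 2 := mul_le_mul_of_nonneg_left h2 ht.1
    _ ≤ _ := mul_le_mul_of_nonneg_right ht.2 h0

lemma memLp_timeIntegral_apply {Ω : Type*} [MeasurableSpace Ω] {P : Measure Ω}
    [IsProbabilityMeasure P] {Y : ℝ → Ω → ℝ} {T t : ℝ} (hm : Measurable (Function.uncurry Y))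
    (hY : MemLp (Function.uncurry Y) 2 ((volume.restrict (Set.Ioc 0 T)).prod P))
    (ht : t ∈ Set.Icc 0 T) : MemLp (timeIntegral Y t) 2 P := by
  have hmeas := (measurable_timeIntegral_apply hm t).aestronglyMeasurable (μ := P)
  rw [memLp_two_iff_integrable_sq hmeas]
  refine Integrable.mono' (hY.integrable_sq.integral_prod_right.const_mul T) (hmeas.pow 2) ?_
  filter_upwards [ae_memLp_two_of_memLp_prod_right hY] with ω hω
  rw [Real.norm_of_nonneg (sq_nonneg _)]
  exact sq_timeIntegral_le ht hω

lemma ae_prod_time_mem {Ω : Type*} [MeasurableSpace Ω] (P : Measure Ω) [SFinite P] (T : ℝ) :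
    ∀ᵐ p ∂((volume.restrict (Set.Ioc 0 T)).prod P), p.1 ∈ Set.Ioc 0 T :=
  Measure.quasiMeasurePreserving_fst.ae (ae_restrict_mem measurableSet_Ioc)

lemma memLp_timeIntegral {Ω : Type*} [MeasurableSpace Ω] {P : Measure Ω}
    [IsProbabilityMeasure P] {Y : ℝ → Ω → ℝ} {T : ℝ} (hm : Measurable (Function.uncurry Y))
    (hY : MemLp (Function.uncurry Y) 2 ((volume.restrict (Set.Ioc 0 T)).prod P)) :
    MemLp (Function.uncurry (timeIntegral Y)) 2 ((volume.restrict (Set.Ioc 0 T)).prod P) := by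
  have hmeas := (measurable_timeIntegral hm).aestronglyMeasurable
    (μ := (volume.restrict (Set.Ioc 0 T)).prod P)
  rw [memLp_two_iff_integrable_sq hmeas]
  refine Integrable.mono' ((hY.integrable_sq.integral_prod_right.const_mul T).comp_snd _)
    (hmeas.pow 2) ?_
  filter_upwards [ae_prod_time_mem P T, Measure.quasiMeasurePreserving_snd.ae
    (ae_memLp_two_of_memLp_prod_right hY)] with p h1 hω
  rw [Real.norm_of_nonneg (sq_nonneg _)]
  exact sq_timeIntegral_le ⟨h1.1.le, h1.2⟩ hω

/-- `Y` is a continuous martingale on `[0, T]`, square integrable on `[0, T] × Ω`, with constant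
expectation `y₀`. The martingale property is expressed by testing against square integrable
random variables that are measurable with respect to the past. -/
structure IsL2Martingale {Ω : Type*} [mΩ : MeasurableSpace Ω] (P : Measure Ω)
    (𝓕 : Filtration ℝ≥0 mΩ) (T y₀ : ℝ) (Y : ℝ → Ω → ℝ) : Prop where
  measurable : Measurable (Function.uncurry Y)
  continuousOn : ∀ᵐ ω ∂P, ContinuousOn (fun t => Y t ω) (Set.Icc 0 T)
  adapted : ∀ t ∈ Set.Icc 0 T, AEStronglyMeasurable[𝓕 t.toNNReal] (Y t) P
  memLp_prod : MemLp (Function.uncurry Y) 2 ((volume.restrict (Set.Ioc 0 T)).prod P)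
  memLp : ∀ t ∈ Set.Icc 0 T, MemLp (Y t) 2 P
  integral_eq : ∀ t ∈ Set.Icc 0 T, ∫ ω, Y t ω ∂P = y₀
  integral_mul_eq : ∀ t u : ℝ, 0 ≤ t → t ≤ u → u ≤ T → ∀ φ : Ω → ℝ,
    AEStronglyMeasurable[𝓕 t.toNNReal] φ P → MemLp φ 2 P →
      ∫ ω, φ ω * Y u ω ∂P = ∫ ω, φ ω * Y t ω ∂P

lemma IsL2Martingale.aestronglyMeasurable_timeIntegral {Ω : Type*} [mΩ : MeasurableSpace Ω]
    {P : Measure Ω} {𝓕 : Filtration ℝ≥0 mΩ} {T y₀ : ℝ} {Y : ℝ → Ω → ℝ}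
    (hY : IsL2Martingale P 𝓕 T y₀ Y) {t : ℝ} (ht : t ∈ Set.Icc 0 T) :
    AEStronglyMeasurable[𝓕 t.toNNReal] (timeIntegral Y t) P := by
  have hsub : Set.Icc 0 t ⊆ Set.Icc 0 T := Set.Icc_subset_Icc_right ht.2
  obtain ⟨Z, hZ, hZY⟩ := exists_jointly_measurable_version (T := t) (z := Y) (𝓕 t.toNNReal)
    (fun s hs => (hY.adapted s (hsub hs)).mono (𝓕.mono (Real.toNNReal_le_toNNReal hs.2)))
    (hY.continuousOn.mono fun ω h => h.mono hsub)
  refine ⟨timeIntegral Z t, ?_, ?_⟩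
  · exact (@measurable_timeIntegral_apply Ω (𝓕 t.toNNReal) Z hZ t).stronglyMeasurable
  · filter_upwards [hZY] with ω hω
    exact setIntegral_congr_fun measurableSet_Ioc fun u hu => (hω u ⟨hu.1.le, hu.2⟩).symm

/-- `timeIntegral Y t + (T - t) * Y t` is the conditional expectation of `timeIntegral Y T`
given the past of `t`. -/
lemma IsL2Martingale.integral_mul_timeIntegral {Ω : Type*} [mΩ : MeasurableSpace Ω]
    {P : Measure Ω} [IsProbabilityMeasure P] {𝓕 : Filtration ℝ≥0 mΩ} {T y₀ : ℝ}
    {Y : ℝ → Ω → ℝ} (hY : IsL2Martingale P 𝓕 T y₀ Y) {t : ℝ} (ht : t ∈ Set.Icc 0 T) {φ : Ω → ℝ}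
    (hφ : AEStronglyMeasurable[𝓕 t.toNNReal] φ P) (hφ2 : MemLp φ 2 P) :
    ∫ ω, φ ω * timeIntegral Y T ω ∂P =
      ∫ ω, φ ω * (timeIntegral Y t ω + (T - t) * Y t ω) ∂P := by
  have hsub : Set.Ioc t T ⊆ Set.Ioc 0 T := Set.Ioc_subset_Ioc_left ht.1
  have hI := memLp_timeIntegral_apply hY.measurable hY.memLp_prod ht
  have hYt := hY.memLp t ht
  have hsplit : (fun ω => φ ω * timeIntegral Y T ω) =ᵐ[P]
      fun ω => φ ω * timeIntegral Y t ω + ∫ u in Set.Ioc t T, φ ω * Y u ω := by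
    filter_upwards [ae_memLp_two_of_memLp_prod_right hY.memLp_prod] with ω hω
    have hint : IntegrableOn (fun u => Y u ω) (Set.Ioc 0 T) := hω.integrable one_le_two
    rw [integral_const_mul, ← mul_add]
    congr 1
    unfold timeIntegral
    rw [← setIntegral_union (Set.Ioc_disjoint_Ioc_of_le le_rfl) measurableSet_Ioc
      (hint.mono_set (Set.Ioc_subset_Ioc_right ht.2)) (hint.mono_set hsub),
      Set.Ioc_union_Ioc_eq_Ioc ht.1 ht.2]
  have hprod : Integrable (fun p : ℝ × Ω => φ p.2 * Y p.1 p.2)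
      ((volume.restrict (Set.Ioc t T)).prod P) := by
    have : Integrable (fun p : ℝ × Ω => φ p.2 * Y p.1 p.2)
        ((volume.restrict (Set.Ioc 0 T)).prod P) :=
      (hφ2.comp_snd _).integrable_mul hY.memLp_prod
    refine this.mono_measure ?_
    exact Measure.prod_mono (Measure.restrict_mono hsub le_rfl) le_rfl
  have hcalc : ∫ ω, (∫ u in Set.Ioc t T, φ ω * Y u ω) ∂P = (T - t) * ∫ ω, φ ω * Y t ω ∂P := by
    rw [integral_integral_swap (f := fun ω u => φ ω * Y u ω) hprod.swap]
    rw [setIntegral_congr_fun measurableSet_Ioc (g := fun _ => ∫ ω, φ ω * Y t ω ∂P)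
      fun u hu => hY.integral_mul_eq t u ht.1 hu.1.le hu.2 φ hφ hφ2]
    rw [setIntegral_const]
    simp [Measure.real, ht.2]
  have hi1 : Integrable (fun ω => φ ω * timeIntegral Y t ω) P := hφ2.integrable_mul hI
  have hi2 : Integrable (fun ω => φ ω * Y t ω) P := hφ2.integrable_mul hYt
  have hi3 : Integrable (fun ω => ∫ u in Set.Ioc t T, φ ω * Y u ω) P := hprod.integral_prod_right
  rw [integral_congr_ae hsplit, integral_add hi1 hi3, hcalc, ← integral_const_mul,
    ← integral_add hi1 (hi2.const_mul _)]
  refine integral_congr_ae (ae_of_all _ fun ω => ?_)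
  simp only
  ring

/-- Square integrability of the combinations of `timeIntegral Y` and `(T - t) * Y` that occur in
the optimal rate and in the martingale closed by `timeIntegral Y T`. -/
lemma IsL2Martingale.memLp_closing {Ω : Type*} [mΩ : MeasurableSpace Ω]
    {P : Measure Ω} [IsProbabilityMeasure P] {𝓕 : Filtration ℝ≥0 mΩ} {T y₀ : ℝ}
    {Y : ℝ → Ω → ℝ} (hY : IsL2Martingale P 𝓕 T y₀ Y) (a b : ℝ) :
    MemLp (fun p : ℝ × Ω => a * timeIntegral Y p.1 p.2 + b * ((T - p.1) * Y p.1 p.2)) 2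
      ((volume.restrict (Set.Ioc 0 T)).prod P) := by
  refine ((memLp_timeIntegral hY.measurable hY.memLp_prod).const_mul a).add (MemLp.const_mul ?_ b)
  refine MemLp.mono (hY.memLp_prod.const_mul T) ?_ ?_
  · exact ((measurable_const.sub measurable_fst).mul hY.measurable).aestronglyMeasurable
  · filter_upwards [ae_prod_time_mem P T] with p hp
    simp only [Function.uncurry, norm_mul, Real.norm_eq_abs]
    refine mul_le_mul_of_nonneg_right ?_ (abs_nonneg _)
    rw [abs_of_nonneg (by linarith [hp.2]), abs_of_nonneg (by linarith [hp.1, hp.2])]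
    linarith [hp.1]

/-- An adapted rate whose time integral vanishes is orthogonal to the martingale closed by
`timeIntegral Y T`: the martingale may be replaced by its terminal value, which does not depend
on time. -/
lemma IsL2Martingale.integral_mul_closing_eq_zero {Ω : Type*} [mΩ : MeasurableSpace Ω]
    {P : Measure Ω} [IsProbabilityMeasure P] {𝓕 : Filtration ℝ≥0 mΩ} {T y₀ : ℝ}
    {Y : ℝ → Ω → ℝ} (hY : IsL2Martingale P 𝓕 T y₀ Y) (hT : 0 ≤ T) {w : ℝ → Ω → ℝ}
    (hw : MemLp (Function.uncurry w) 2 ((volume.restrict (Set.Ioc 0 T)).prod P))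
    (hwa : ∀ t ∈ Set.Ioc 0 T, AEStronglyMeasurable[𝓕 t.toNNReal] (w t) P)
    (hw0 : ∀ᵐ ω ∂P, ∫ t in Set.Ioc 0 T, w t ω = 0) :
    ∫ p, w p.1 p.2 * (timeIntegral Y p.1 p.2 + (T - p.1) * Y p.1 p.2)
      ∂((volume.restrict (Set.Ioc 0 T)).prod P) = 0 := by
  have hN := hY.memLp_closing 1 1
  simp only [one_mul] at hN
  have hIT := memLp_timeIntegral_apply hY.measurable hY.memLp_prod (Set.right_mem_Icc.2 hT)
  have h1 : Integrable (fun p : ℝ × Ω => w p.1 p.2 * timeIntegral Y T p.2)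
      ((volume.restrict (Set.Ioc 0 T)).prod P) := hw.integrable_mul (hIT.comp_snd _)
  have h2 : Integrable (fun p : ℝ × Ω =>
      w p.1 p.2 * (timeIntegral Y p.1 p.2 + (T - p.1) * Y p.1 p.2))
      ((volume.restrict (Set.Ioc 0 T)).prod P) := hw.integrable_mul hN
  rw [integral_prod _ h2]
  have : ∫ t in Set.Ioc 0 T, ∫ ω, w t ω * (timeIntegral Y t ω + (T - t) * Y t ω) ∂P =
      ∫ t in Set.Ioc 0 T, ∫ ω, w t ω * timeIntegral Y T ω ∂P := by
    refine integral_congr_ae ?_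
    filter_upwards [ae_memLp_two_of_memLp_prod hw, ae_restrict_mem measurableSet_Ioc] with t h2 ht
    exact (hY.integral_mul_timeIntegral ⟨ht.1.le, ht.2⟩ (hwa t ht) h2).symm
  refine this.trans ?_
  rw [integral_integral_swap h1]
  refine integral_eq_zero_of_ae ?_
  filter_upwards [hw0] with ω hω
  rw [integral_mul_const, hω, zero_mul]
  rfl

/-! ### Pathwise identities for the time integral -/

lemma hasDerivAt_timeIntegral {Ω : Type*} {Y : ℝ → Ω → ℝ} {T : ℝ} {ω : Ω}
    (hc : ContinuousOn (fun t => Y t ω) (Set.Icc 0 T)) {t : ℝ} (ht : t ∈ Set.Ioo 0 T) :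
    HasDerivAt (fun s => timeIntegral Y s ω) (Y t ω) t := by
  have hT : (0 : ℝ) ≤ T := (ht.1.trans ht.2).le
  have h : HasDerivAt (fun s => ∫ u in (0 : ℝ)..s, Y u ω) (Y t ω) t := by
    refine intervalIntegral.integral_hasDerivAt_right ?_ ?_ ?_
    · refine (hc.mono ?_).intervalIntegrable
      rw [Set.uIcc_of_le ht.1.le]
      exact Set.Icc_subset_Icc_right ht.2.le
    · exact ContinuousOn.stronglyMeasurableAtFilter isOpen_Ioo
        (hc.mono Set.Ioo_subset_Icc_self) t ht
    · exact hc.continuousAt (Icc_mem_nhds ht.1 ht.2)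
  refine h.congr_of_eventuallyEq ?_
  filter_upwards [lt_mem_nhds ht.1] with s hs
  exact timeIntegral_eq_intervalIntegral Y hs.le ω

lemma continuousOn_timeIntegral {Ω : Type*} {Y : ℝ → Ω → ℝ} {T : ℝ} {ω : Ω} (hT : 0 ≤ T)
    (hc : ContinuousOn (fun t => Y t ω) (Set.Icc 0 T)) :
    ContinuousOn (fun s => timeIntegral Y s ω) (Set.Icc 0 T) := by
  have h := intervalIntegral.continuousOn_primitive_interval (μ := volume)
    (f := fun t => Y t ω) (a := 0) (b := T)
    (by rw [Set.uIcc_of_le hT]; exact hc.integrableOn_Icc)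
  rw [Set.uIcc_of_le hT] at h
  exact h.congr fun s hs => timeIntegral_eq_intervalIntegral Y hs.1 ω

lemma timeIntegral_zero {Ω : Type*} (Y : ℝ → Ω → ℝ) (ω : Ω) : timeIntegral Y 0 ω = 0 := by
  simp [timeIntegral]

/-- The integrand is the derivative of `-(T - t) * timeIntegral Y t`. -/
lemma integral_timeIntegral_sub {Ω : Type*} {Y : ℝ → Ω → ℝ} {T : ℝ} {ω : Ω} (hT : 0 ≤ T)
    (hc : ContinuousOn (fun t => Y t ω) (Set.Icc 0 T)) :
    ∫ t in Set.Ioc 0 T, (timeIntegral Y t ω - (T - t) * Y t ω) = 0 := by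
  have hI := continuousOn_timeIntegral hT hc
  have hcont : ContinuousOn (fun t => timeIntegral Y t ω - (T - t) * Y t ω) (Set.Icc 0 T) := by
    fun_prop
  rw [← intervalIntegral.integral_of_le hT,
    intervalIntegral.integral_eq_sub_of_hasDerivAt_of_le hT
      (f := fun t => -((T - t) * timeIntegral Y t ω)) (by fun_prop) ?_
      (hcont.intervalIntegrable_of_Icc hT)]
  · simp [timeIntegral_zero]
  · intro t ht
    have h := (((hasDerivAt_id t).const_sub T).mul (hasDerivAt_timeIntegral hc ht)).neg
    exact h.congr_deriv (by simp; ring)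

/-- The two integrands differ by the derivative of `-(T - t) * timeIntegral Y t ^ 2`. -/
lemma integral_sq_timeIntegral_sub {Ω : Type*} {Y : ℝ → Ω → ℝ} {T : ℝ} {ω : Ω} (hT : 0 ≤ T)
    (hc : ContinuousOn (fun t => Y t ω) (Set.Icc 0 T)) :
    ∫ t in Set.Ioc 0 T, (timeIntegral Y t ω - (T - t) * Y t ω) ^ 2 =
      ∫ t in Set.Ioc 0 T, ((T - t) * Y t ω) ^ 2 := by
  have hI := continuousOn_timeIntegral hT hc
  have h1 : ContinuousOn
      (fun t => timeIntegral Y t ω ^ 2 - 2 * (T - t) * (timeIntegral Y t ω * Y t ω))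
      (Set.Icc 0 T) := by fun_prop
  have h2 : ContinuousOn (fun t => ((T - t) * Y t ω) ^ 2) (Set.Icc 0 T) := by fun_prop
  have h0 : ∫ t in (0 : ℝ)..T,
      (timeIntegral Y t ω ^ 2 - 2 * (T - t) * (timeIntegral Y t ω * Y t ω)) = 0 := by
    rw [intervalIntegral.integral_eq_sub_of_hasDerivAt_of_le hT
      (f := fun t => -((T - t) * timeIntegral Y t ω ^ 2)) (by fun_prop) ?_
      (h1.intervalIntegrable_of_Icc hT)]
    · simp [timeIntegral_zero]
    · intro t ht
      have h := (((hasDerivAt_id t).const_sub T).mul ((hasDerivAt_timeIntegral hc ht).pow 2)).neg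
      exact h.congr_deriv (by simp; ring)
  rw [← intervalIntegral.integral_of_le hT, ← intervalIntegral.integral_of_le hT,
    ← sub_eq_zero, ← intervalIntegral.integral_sub
      ((by fun_prop : ContinuousOn (fun t => (timeIntegral Y t ω - (T - t) * Y t ω) ^ 2)
        (Set.Icc 0 T)).intervalIntegrable_of_Icc hT) (h2.intervalIntegrable_of_Icc hT)]
  refine Eq.trans ?_ h0
  refine intervalIntegral.integral_congr fun t _ => ?_
  ring

/-! ### The quadratic problem for trading rates -/

/-- Admissible trading rates: adapted, square integrable on `[0, T] × Ω`, and liquidating the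
position `X` by time `T`. -/
structure IsAdmissibleRate {Ω : Type*} [mΩ : MeasurableSpace Ω] (P : Measure Ω)
    (𝓕 : Filtration ℝ≥0 mΩ) (T X : ℝ) (v : ℝ → Ω → ℝ) : Prop where
  memLp : MemLp (Function.uncurry v) 2 ((volume.restrict (Set.Ioc 0 T)).prod P)
  adapted : ∀ t ∈ Set.Ioc 0 T, AEStronglyMeasurable[𝓕 t.toNNReal] (v t) P
  integral_eq : ∀ᵐ ω ∂P, ∫ t in Set.Ioc 0 T, v t ω = -X

/-- The expected cost of the trading rate `v`, after integrating by parts in time. -/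
noncomputable def rateCost {Ω : Type*} [MeasurableSpace Ω] (P : Measure Ω) (Y : ℝ → Ω → ℝ)
    (T c : ℝ) (v : ℝ → Ω → ℝ) : ℝ :=
  ∫ p, (v p.1 p.2 ^ 2 - c * (timeIntegral Y p.1 p.2 * v p.1 p.2))
    ∂((volume.restrict (Set.Ioc 0 T)).prod P)

/-- The time derivative of the optimal strategy. -/
noncomputable def optimalRate {Ω : Type*} (Y : ℝ → Ω → ℝ) (T X c : ℝ) (t : ℝ) (ω : Ω) : ℝ :=
  -X / T + c / 4 * (timeIntegral Y t ω - (T - t) * Y t ω)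

section Rate

variable {Ω : Type*} [mΩ : MeasurableSpace Ω] {P : Measure Ω} [IsProbabilityMeasure P]
  {𝓕 : Filtration ℝ≥0 mΩ} {T y₀ X : ℝ} {Y v : ℝ → Ω → ℝ}

lemma IsL2Martingale.memLp_timeIntegral_sub (hY : IsL2Martingale P 𝓕 T y₀ Y) :
    MemLp (fun p : ℝ × Ω => timeIntegral Y p.1 p.2 - (T - p.1) * Y p.1 p.2) 2
      ((volume.restrict (Set.Ioc 0 T)).prod P) := by
  have h := hY.memLp_closing 1 (-1)
  simpa only [one_mul, neg_one_mul, ← sub_eq_add_neg] using h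

lemma isAdmissibleRate_const (P : Measure Ω) [IsProbabilityMeasure P]
    (𝓕 : Filtration ℝ≥0 mΩ) (X : ℝ) (hT : 0 < T) :
    IsAdmissibleRate P 𝓕 T X (fun _ _ => -X / T) where
  memLp := memLp_const (-X / T)
  adapted _ _ := aestronglyMeasurable_const
  integral_eq := ae_of_all _ fun _ => by
    rw [setIntegral_const]
    simp [Measure.real, hT.le]
    field_simp

lemma IsL2Martingale.isAdmissibleRate_optimalRate (hY : IsL2Martingale P 𝓕 T y₀ Y) (hT : 0 < T)
    (X c : ℝ) : IsAdmissibleRate P 𝓕 T X (optimalRate Y T X c) where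
  memLp := (memLp_const (-X / T)).add (hY.memLp_timeIntegral_sub.const_mul (c / 4))
  adapted t ht := by
    have ht' : t ∈ Set.Icc 0 T := ⟨ht.1.le, ht.2⟩
    exact aestronglyMeasurable_const.add
      (((hY.aestronglyMeasurable_timeIntegral ht').sub
        ((hY.adapted t ht').const_mul _)).const_mul _)
  integral_eq := by
    filter_upwards [hY.continuousOn, ae_memLp_two_of_memLp_prod_right
      (f := fun t ω => timeIntegral Y t ω - (T - t) * Y t ω) hY.memLp_timeIntegral_sub] with ω h1 h2
    unfold optimalRate
    rw [integral_add (integrable_const _) ((h2.integrable one_le_two).const_mul _),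
      integral_const_mul, integral_timeIntegral_sub hT.le h1, setIntegral_const]
    simp [Measure.real, hT.le]
    field_simp

/-- Expansion of the quadratic cost around the optimal rate. The first order term vanishes since
`2 * optimalRate - c * timeIntegral Y` is a multiple of the martingale closed by
`timeIntegral Y T`, up to a constant. -/
lemma IsL2Martingale.rateCost_eq_add (hY : IsL2Martingale P 𝓕 T y₀ Y) (hT : 0 < T) (c : ℝ)
    (hv : IsAdmissibleRate P 𝓕 T X v) :
    rateCost P Y T c v = rateCost P Y T c (optimalRate Y T X c) +
      ∫ p, (v p.1 p.2 - optimalRate Y T X c p.1 p.2) ^ 2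
        ∂((volume.restrict (Set.Ioc 0 T)).prod P) := by
  have ho := hY.isAdmissibleRate_optimalRate hT X c
  set o := optimalRate Y T X c
  have hI := memLp_timeIntegral hY.measurable hY.memLp_prod
  have hw : MemLp (Function.uncurry fun t ω => v t ω - o t ω) 2
      ((volume.restrict (Set.Ioc 0 T)).prod P) := hv.memLp.sub ho.memLp
  have hw0 : ∀ᵐ ω ∂P, ∫ t in Set.Ioc 0 T, (v t ω - o t ω) = 0 := by
    filter_upwards [hv.integral_eq, ho.integral_eq, ae_memLp_two_of_memLp_prod_right hv.memLp,
      ae_memLp_two_of_memLp_prod_right ho.memLp] with ω h1 h2 h3 h4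
    rw [integral_sub (h3.integrable one_le_two) (h4.integrable one_le_two), h1, h2, sub_self]
  have horth := hY.integral_mul_closing_eq_zero hT.le hw
    (fun t ht => (hv.adapted t ht).sub (ho.adapted t ht)) hw0
  have hmean : ∫ p, (v p.1 p.2 - o p.1 p.2) ∂((volume.restrict (Set.Ioc 0 T)).prod P) = 0 := by
    exact (integral_prod_symm _ (hw.integrable one_le_two)).trans (integral_eq_zero_of_ae hw0)
  have hN := hY.memLp_closing 1 1
  simp only [one_mul] at hN
  have i1 : Integrable (fun p : ℝ × Ω => o p.1 p.2 ^ 2 - c * (timeIntegral Y p.1 p.2 * o p.1 p.2))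
      ((volume.restrict (Set.Ioc 0 T)).prod P) :=
    ho.memLp.integrable_sq.sub ((hI.integrable_mul ho.memLp).const_mul c)
  have i2 : Integrable (fun p : ℝ × Ω => (v p.1 p.2 - o p.1 p.2) ^ 2)
      ((volume.restrict (Set.Ioc 0 T)).prod P) := hw.integrable_sq
  have i3 : Integrable (fun p : ℝ × Ω => v p.1 p.2 - o p.1 p.2)
      ((volume.restrict (Set.Ioc 0 T)).prod P) := hw.integrable one_le_two
  have i4 : Integrable (fun p : ℝ × Ω =>
      (v p.1 p.2 - o p.1 p.2) * (timeIntegral Y p.1 p.2 + (T - p.1) * Y p.1 p.2))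
      ((volume.restrict (Set.Ioc 0 T)).prod P) := hw.integrable_mul hN
  have e : ∀ p : ℝ × Ω, v p.1 p.2 ^ 2 - c * (timeIntegral Y p.1 p.2 * v p.1 p.2) =
      (o p.1 p.2 ^ 2 - c * (timeIntegral Y p.1 p.2 * o p.1 p.2) + (v p.1 p.2 - o p.1 p.2) ^ 2) +
      ((-2 * X / T) * (v p.1 p.2 - o p.1 p.2) + (-c / 2) *
        ((v p.1 p.2 - o p.1 p.2) * (timeIntegral Y p.1 p.2 + (T - p.1) * Y p.1 p.2))) := by
    intro p
    have : o p.1 p.2 =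
      -X / T + c / 4 * (timeIntegral Y p.1 p.2 - (T - p.1) * Y p.1 p.2) := rfl
    rw [this]
    ring
  unfold rateCost
  simp_rw [e]
  rw [integral_add (by exact i1.add i2) (by exact (i3.const_mul _).add (i4.const_mul _)),
    integral_add i1 i2,
    integral_add (i3.const_mul _) (i4.const_mul _), integral_const_mul, integral_const_mul, horth,
    hmean]
  simp

lemma IsL2Martingale.integral_timeIntegral_prod (hY : IsL2Martingale P 𝓕 T y₀ Y) (hT : 0 ≤ T) :
    ∫ p, timeIntegral Y p.1 p.2 ∂((volume.restrict (Set.Ioc 0 T)).prod P) = y₀ * T ^ 2 / 2 := by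
  have h1 : MemLp (fun p : ℝ × Ω => (T - p.1) * Y p.1 p.2) 2
      ((volume.restrict (Set.Ioc 0 T)).prod P) := by simpa using hY.memLp_closing 0 1
  have h2 := memLp_timeIntegral hY.measurable hY.memLp_prod
  have h3 : ∫ p, (timeIntegral Y p.1 p.2 - (T - p.1) * Y p.1 p.2)
      ∂((volume.restrict (Set.Ioc 0 T)).prod P) = 0 := by
    rw [integral_prod_symm _ (hY.memLp_timeIntegral_sub.integrable one_le_two)]
    exact integral_eq_zero_of_ae
      (hY.continuousOn.mono fun ω h => integral_timeIntegral_sub hT h)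
  have h2' : Integrable (fun p : ℝ × Ω => timeIntegral Y p.1 p.2)
      ((volume.restrict (Set.Ioc 0 T)).prod P) := h2.integrable one_le_two
  rw [integral_sub h2' (h1.integrable one_le_two), sub_eq_zero] at h3
  rw [h3, integral_prod _ (h1.integrable one_le_two)]
  rw [setIntegral_congr_fun measurableSet_Ioc (g := fun t => (T - t) * y₀)
    fun t ht => by
      simp only
      rw [integral_const_mul, hY.integral_eq t ⟨ht.1.le, ht.2⟩]]
  rw [← intervalIntegral.integral_of_le hT, intervalIntegral.integral_mul_const,
    intervalIntegral.integral_sub (by simp) (by simp)]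
  simp
  ring

lemma IsL2Martingale.integral_sq_timeIntegral_sub_prod (hY : IsL2Martingale P 𝓕 T y₀ Y)
    (hT : 0 ≤ T) :
    ∫ p, (timeIntegral Y p.1 p.2 - (T - p.1) * Y p.1 p.2) ^ 2
      ∂((volume.restrict (Set.Ioc 0 T)).prod P) =
        ∫ t in (0 : ℝ)..T, (T - t) ^ 2 * ∫ ω, Y t ω ^ 2 ∂P := by
  have h1 : MemLp (fun p : ℝ × Ω => (T - p.1) * Y p.1 p.2) 2
      ((volume.restrict (Set.Ioc 0 T)).prod P) := by simpa using hY.memLp_closing 0 1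
  rw [integral_prod_symm _ hY.memLp_timeIntegral_sub.integrable_sq,
    integral_congr_ae (hY.continuousOn.mono fun ω h => integral_sq_timeIntegral_sub hT h),
    ← integral_prod_symm _ h1.integrable_sq, integral_prod _ h1.integrable_sq,
    intervalIntegral.integral_of_le hT]
  refine integral_congr_ae (ae_of_all _ fun t => ?_)
  simp_rw [mul_pow, integral_const_mul]

/-- The optimal cost, obtained by expanding the cost of selling at constant rate around the
optimal rate. -/
lemma IsL2Martingale.rateCost_optimalRate (hY : IsL2Martingale P 𝓕 T y₀ Y) (hT : 0 < T)
    (X c : ℝ) :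
    rateCost P Y T c (optimalRate Y T X c) = X ^ 2 / T + c * T * X * y₀ / 2 -
      c ^ 2 / 16 * ∫ t in (0 : ℝ)..T, (T - t) ^ 2 * ∫ ω, Y t ω ^ 2 ∂P := by
  have h := hY.rateCost_eq_add hT c (isAdmissibleRate_const P 𝓕 X hT)
  have h1 : rateCost P Y T c (fun _ _ => -X / T) = X ^ 2 / T + c * T * X * y₀ / 2 := by
    have hI : Integrable (fun p : ℝ × Ω => timeIntegral Y p.1 p.2)
      ((volume.restrict (Set.Ioc 0 T)).prod P) :=
      (memLp_timeIntegral hY.measurable hY.memLp_prod).integrable one_le_two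
    unfold rateCost
    rw [integral_sub (integrable_const _) ((hI.mul_const _).const_mul _), integral_const_mul,
      integral_mul_const, hY.integral_timeIntegral_prod hT.le, integral_const]
    have : ((volume.restrict (Set.Ioc 0 T)).prod P).real Set.univ = T := by
      rw [← Set.univ_prod_univ, measureReal_prod_prod]
      simp [Measure.real, hT.le]
    rw [this, smul_eq_mul]
    field_simp
    ring
  have h2 : ∫ p, (-X / T - optimalRate Y T X c p.1 p.2) ^ 2
      ∂((volume.restrict (Set.Ioc 0 T)).prod P) =
      c ^ 2 / 16 * ∫ t in (0 : ℝ)..T, (T - t) ^ 2 * ∫ ω, Y t ω ^ 2 ∂P := by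
    rw [← hY.integral_sq_timeIntegral_sub_prod hT.le, ← integral_const_mul]
    refine integral_congr_ae (ae_of_all _ fun p => ?_)
    simp only [optimalRate]
    ring
  linarith

end Rate

/-! ### Extended expectations of costs bounded below -/

lemma extendedExpectation_congr {Ω : Type*} [MeasurableSpace Ω] {P : Measure Ω} {f g : Ω → EReal}
    (h : f =ᵐ[P] g) : extendedExpectation P f = extendedExpectation P g := by
  have h1 : ∫⁻ ω, (f ω).toENNReal ∂P = ∫⁻ ω, (g ω).toENNReal ∂P :=
    lintegral_congr_ae (h.mono fun ω hω => by simp only [hω])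
  have h2 : ∫⁻ ω, (-f ω).toENNReal ∂P = ∫⁻ ω, (-g ω).toENNReal ∂P :=
    lintegral_congr_ae (h.mono fun ω hω => by simp only [hω])
  unfold extendedExpectation
  rw [h1, h2]

lemma extendedExpectation_coe {Ω : Type*} [MeasurableSpace Ω] {P : Measure Ω} {f : Ω → ℝ}
    (hf : Integrable f P) : extendedExpectation P (fun ω => (f ω : EReal)) =
      ((∫ ω, f ω ∂P : ℝ) : EReal) := by
  unfold extendedExpectation
  have h1 : ∫⁻ ω, ENNReal.ofReal (f ω) ∂P ≠ ∞ := hf.lintegral_lt_top.ne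
  have h2 : ∫⁻ ω, ENNReal.ofReal (-f ω) ∂P ≠ ∞ := hf.neg.lintegral_lt_top.ne
  rw [integral_eq_lintegral_pos_part_sub_lintegral_neg_part hf]
  simp only [← EReal.coe_neg, EReal.real_coe_toENNReal]
  rw [EReal.coe_sub, EReal.coe_ennreal_toReal h1, EReal.coe_ennreal_toReal h2]

/-- An extended random variable whose nonnegative part `A` dominates the rest up to an integrable
error has expectation `⊤` as soon as `A` has infinite expectation. -/
lemma extendedExpectation_eq_top {Ω : Type*} [MeasurableSpace Ω] {P : Measure Ω}
    {A : Ω → ℝ≥0∞} {B G : Ω → ℝ} (hG : Integrable G P)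
    (hA : ∫⁻ ω, A ω ∂P = ∞) (hAm : AEMeasurable A P)
    (hB : ∀ᵐ ω ∂P, A ω ≠ ∞ → |B ω| ≤ (A ω).toReal / 2 + G ω) :
    extendedExpectation P (fun ω => (A ω : EReal) + (B ω : EReal)) = ⊤ := by
  have hneg : ∀ᵐ ω ∂P, (-((A ω : EReal) + (B ω : EReal))).toENNReal ≤ ENNReal.ofReal (G ω) := by
    filter_upwards [hB] with ω hω
    by_cases h : A ω = ∞
    · simp [h]
    · have hb := abs_le.1 (hω h)
      have ha : 0 ≤ (A ω).toReal := ENNReal.toReal_nonneg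
      rw [← EReal.coe_ennreal_toReal h, ← EReal.coe_add, ← EReal.coe_neg,
        EReal.real_coe_toENNReal]
      exact ENNReal.ofReal_le_ofReal (by linarith)
  have hpos : ∀ᵐ ω ∂P, A ω / 2 ≤
      ((A ω : EReal) + (B ω : EReal)).toENNReal + ENNReal.ofReal (G ω) := by
    filter_upwards [hB] with ω hω
    by_cases h : A ω = ∞
    · simp [h]
    · have hb := abs_le.1 (hω h)
      have ha : 0 ≤ (A ω).toReal := ENNReal.toReal_nonneg
      rw [← EReal.coe_ennreal_toReal h, ← EReal.coe_add, EReal.real_coe_toENNReal]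
      calc A ω / 2 = ENNReal.ofReal ((A ω).toReal / 2) := by
            rw [ENNReal.ofReal_div_of_pos two_pos, ENNReal.ofReal_toReal h]; simp
        _ ≤ ENNReal.ofReal (((A ω).toReal + B ω) + G ω) := ENNReal.ofReal_le_ofReal (by linarith)
        _ ≤ _ := ENNReal.ofReal_add_le
  have hGfin : ∫⁻ ω, ENNReal.ofReal (G ω) ∂P ≠ ∞ := hG.lintegral_lt_top.ne
  have h1 : ∫⁻ ω, (-((A ω : EReal) + (B ω : EReal))).toENNReal ∂P ≠ ∞ :=
    ((lintegral_mono_ae hneg).trans_lt hGfin.lt_top).ne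
  have h2 : ∫⁻ ω, ((A ω : EReal) + (B ω : EReal)).toENNReal ∂P = ∞ := by
    have h3 : ∫⁻ ω, A ω / 2 ∂P = ∞ := by
      simp_rw [div_eq_mul_inv]
      rw [lintegral_mul_const'' _ hAm, hA]
      simp
    have h4 := lintegral_mono_ae hpos
    rw [h3, lintegral_add_right' _ hG.1.aemeasurable.ennreal_ofReal, top_le_iff,
      ENNReal.add_eq_top] at h4
    exact h4.resolve_right hGfin
  unfold extendedExpectation
  rw [h2, EReal.coe_ennreal_top, EReal.top_sub]
  simpa using h1

/-! ### From strategies to trading rates -/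

/-- Integration by parts: the boundary terms vanish since `f T = 0` and `timeIntegral Y 0 = 0`. -/
lemma integral_mul_eq_neg_integral_timeIntegral_mul_deriv {Ω : Type*} {Y : ℝ → Ω → ℝ} {T : ℝ}
    {ω : Ω} {f : ℝ → ℝ} (hT : 0 ≤ T) (hc : ContinuousOn (fun t => Y t ω) (Set.Icc 0 T))
    (hf : AbsolutelyContinuousOnInterval f 0 T) (hfT : f T = 0) :
    ∫ t in (0 : ℝ)..T, f t * Y t ω = -∫ t in Set.Ioc 0 T, timeIntegral Y t ω * deriv f t := by
  have hg : AbsolutelyContinuousOnInterval (fun t => ∫ u in (0 : ℝ)..t, Y u ω) 0 T :=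
    (hc.intervalIntegrable_of_Icc hT).absolutelyContinuousOnInterval_intervalIntegral
      Set.left_mem_uIcc
  have h := hf.integral_mul_deriv_eq_deriv_mul hg
  have h1 : ∫ t in (0 : ℝ)..T, f t * Y t ω =
      ∫ t in (0 : ℝ)..T, f t * deriv (fun t => ∫ u in (0 : ℝ)..t, Y u ω) t := by
    rw [intervalIntegral.integral_of_le hT, intervalIntegral.integral_of_le hT,
      integral_Ioc_eq_integral_Ioo, integral_Ioc_eq_integral_Ioo]
    refine setIntegral_congr_fun measurableSet_Ioo fun t ht => ?_
    have hd : HasDerivAt (fun s => ∫ u in (0 : ℝ)..s, Y u ω) (Y t ω) t := by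
      refine (hasDerivAt_timeIntegral hc ht).congr_of_eventuallyEq ?_
      filter_upwards [lt_mem_nhds ht.1] with s hs
      exact (timeIntegral_eq_intervalIntegral Y hs.le ω).symm
    simp only [hd.deriv]
  rw [h1, h, hfT, intervalIntegral.integral_same, zero_mul, mul_zero, sub_zero, zero_sub,
    intervalIntegral.integral_of_le hT]
  congr 1
  refine setIntegral_congr_fun measurableSet_Ioc fun t ht => ?_
  rw [timeIntegral_eq_intervalIntegral Y ht.1.le, mul_comm]

/-- The rate `v` is, almost surely and at almost every time of `[0, T]`, the time derivative of
the strategy `x`. -/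
def IsRateOf {Ω : Type*} [MeasurableSpace Ω] (P : Measure Ω) (T : ℝ) (x v : ℝ → Ω → ℝ) : Prop :=
  ∀ᵐ ω ∂P, ∀ᵐ t ∂(volume.restrict (Set.Ioc 0 T)), v t ω = deriv (fun s => x s ω) t

section Strategy

variable {Ω : Type*} [mΩ : MeasurableSpace Ω] {P : Measure Ω}
  {𝓕 : Filtration ℝ≥0 mΩ} {S : ℝ≥0 → Ω → ℝ} {K T y₀ X : ℝ} {Y x v : ℝ → Ω → ℝ}

lemma IsAdmissibleStrategy.aestronglyMeasurable (hx : IsAdmissibleStrategy P 𝓕 T X x) :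
    ∀ t ∈ Set.Icc 0 T, AEStronglyMeasurable[𝓕 t.toNNReal] (x t) P := by
  intro t ht
  have h := hx.adapted t.toNNReal (by rw [Real.coe_toNNReal t ht.1]; exact ht.2)
  rwa [Real.coe_toNNReal t ht.1] at h

lemma IsAdmissibleStrategy.ae_eq_add_integral (hx : IsAdmissibleStrategy P 𝓕 T X x)
    (hv : IsRateOf P T x v) :
    ∀ᵐ ω ∂P, ∀ t ∈ Set.Icc 0 T, x t ω = X + ∫ u in Set.Ioc 0 t, v u ω := by
  filter_upwards [hx.absolutelyContinuous, hx.initial, hv] with ω h1 h2 h3 t ht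
  have hsub : Set.Ioc 0 t ⊆ Set.Ioc 0 T := Set.Ioc_subset_Ioc_right ht.2
  have h4 : AbsolutelyContinuousOnInterval (fun s => x s ω) 0 t := by
    refine h1.mono ?_
    rw [Set.uIcc_of_le ht.1, Set.uIcc_of_le (ht.1.trans ht.2)]
    exact Set.Icc_subset_Icc_right ht.2
  have h5 := h4.integral_deriv_eq_sub
  rw [intervalIntegral.integral_of_le ht.1] at h5
  rw [integral_congr_ae (ae_restrict_of_ae_restrict_of_subset hsub h3), h5, h2]
  ring

lemma IsAdmissibleStrategy.pathCost_ae_eq (hx : IsAdmissibleStrategy P 𝓕 T X x) (hT : 0 ≤ T)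
    (hY : IsL2Martingale P 𝓕 T y₀ Y)
    (hSY : ∀ᵐ ω ∂P, ∀ t ∈ Set.Icc 0 T, Y t ω = S t.toNNReal ω - K)
    (hv : IsRateOf P T x v) (c : ℝ) :
    pathCost S K T c x =ᵐ[P] fun ω =>
      ((∫⁻ t in Set.Ioc 0 T, ENNReal.ofReal (v t ω ^ 2) : ℝ≥0∞) : EReal) +
        ((-(c * ∫ t in Set.Ioc 0 T, timeIntegral Y t ω * v t ω) : ℝ) : EReal) := by
  filter_upwards [hx.absolutelyContinuous, hx.terminal, hv, hSY, hY.continuousOn]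
    with ω h1 h2 h3 h4 h5
  have e1 : ∫⁻ t in Set.Icc 0 T, ENNReal.ofReal (deriv (fun s => x s ω) t ^ 2) =
      ∫⁻ t in Set.Ioc 0 T, ENNReal.ofReal (v t ω ^ 2) := by
    rw [setLIntegral_congr Ioc_ae_eq_Icc.symm]
    exact lintegral_congr_ae (h3.mono fun t ht => by simp only [ht])
  have e2 : ∫ t in (0 : ℝ)..T, x t ω * (S t.toNNReal ω - K) =
      -∫ t in Set.Ioc 0 T, timeIntegral Y t ω * v t ω := by
    have e3 : ∫ t in Set.Ioc 0 T, timeIntegral Y t ω * v t ω =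
        ∫ t in Set.Ioc 0 T, timeIntegral Y t ω * deriv (fun s => x s ω) t :=
      integral_congr_ae (h3.mono fun t ht => by simp only [ht])
    rw [e3, ← integral_mul_eq_neg_integral_timeIntegral_mul_deriv hT h5 h1 h2]
    refine intervalIntegral.integral_congr fun t ht => ?_
    rw [Set.uIcc_of_le hT] at ht
    simp only [h4 t ht]
  unfold pathCost
  rw [e1, e2, mul_neg]

lemma optimalStrategy_eq (hSY : ∀ᵐ ω ∂P, ∀ t ∈ Set.Icc 0 T, Y t ω = S t.toNNReal ω - K)
    (X c : ℝ) : ∀ᵐ ω ∂P, ∀ t ∈ Set.Icc 0 T, optimalStrategy S K T X c t ω =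
      (T - t) / T * (X - c * (T / 4) * timeIntegral Y t ω) := by
  filter_upwards [hSY] with ω h t ht
  have : ∫ u in (0 : ℝ)..t, (S u.toNNReal ω - K) = timeIntegral Y t ω := by
    rw [intervalIntegral.integral_of_le ht.1]
    exact setIntegral_congr_fun measurableSet_Ioc
      fun u hu => (h u ⟨hu.1.le, hu.2.trans ht.2⟩).symm
  rw [optimalStrategy, this]

lemma IsAdmissibleStrategy.isAdmissibleRate (hx : IsAdmissibleStrategy P 𝓕 T X x) (hT : 0 ≤ T)
    (hv : IsRateOf P T x v)
    (hL2 : MemLp (Function.uncurry v) 2 ((volume.restrict (Set.Ioc 0 T)).prod P))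
    (hva : ∀ t ∈ Set.Ioc 0 T, AEStronglyMeasurable[𝓕 t.toNNReal] (v t) P) :
    IsAdmissibleRate P 𝓕 T X v where
  memLp := hL2
  adapted := hva
  integral_eq := by
    filter_upwards [hx.ae_eq_add_integral hv, hx.terminal] with ω h1 h2
    have := h1 T (Set.right_mem_Icc.2 hT)
    linarith

lemma IsL2Martingale.isAdmissibleStrategy_optimalStrategy (hY : IsL2Martingale P 𝓕 T y₀ Y)
    (hT : 0 < T) (hSY : ∀ᵐ ω ∂P, ∀ t ∈ Set.Icc 0 T, Y t ω = S t.toNNReal ω - K) (X c : ℝ) :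
    IsAdmissibleStrategy P 𝓕 T X (optimalStrategy S K T X c) where
  adapted t ht := by
    have ht' : (t : ℝ) ∈ Set.Icc 0 T := ⟨t.2, ht⟩
    have h := hY.aestronglyMeasurable_timeIntegral ht'
    rw [Real.toNNReal_coe] at h
    have h2 : AEStronglyMeasurable[𝓕 t]
        (fun ω => (T - t) / T * (X - c * (T / 4) * timeIntegral Y t ω)) P :=
      (aestronglyMeasurable_const.sub (h.const_mul _)).const_mul _
    exact h2.congr ((optimalStrategy_eq hSY X c).mono fun ω hω => (hω t ht').symm)
  absolutelyContinuous := by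
    filter_upwards [hSY, hY.continuousOn] with ω h1 h2
    have h3 : IntervalIntegrable (fun u => S u.toNNReal ω - K) volume 0 T :=
      (h2.congr fun t ht => (h1 t ht).symm).intervalIntegrable_of_Icc hT.le
    have h4 := h3.absolutelyContinuousOnInterval_intervalIntegral
      (Set.left_mem_uIcc (a := (0 : ℝ)) (b := T))
    have h5 : AbsolutelyContinuousOnInterval (fun _ : ℝ => X) 0 T :=
      contDiffOn_const.absolutelyContinuousOnInterval
    have h6 : AbsolutelyContinuousOnInterval (fun t : ℝ => (T - t) / T) 0 T := by
      refine ContDiffOn.absolutelyContinuousOnInterval ?_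
      exact ((contDiff_const.sub contDiff_id).div_const T).contDiffOn
    exact h6.fun_mul (h5.fun_sub (h4.const_mul (c * (T / 4))))
  initial := ae_of_all _ fun ω => by
    simp [optimalStrategy, hT.ne']
  terminal := ae_of_all _ fun ω => by
    simp [optimalStrategy]

lemma IsL2Martingale.isRateOf_optimalStrategy (hY : IsL2Martingale P 𝓕 T y₀ Y)
    (hT : 0 < T) (hSY : ∀ᵐ ω ∂P, ∀ t ∈ Set.Icc 0 T, Y t ω = S t.toNNReal ω - K) (X c : ℝ) :
    IsRateOf P T (optimalStrategy S K T X c) (optimalRate Y T X c) := by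
  filter_upwards [optimalStrategy_eq hSY X c, hY.continuousOn] with ω h1 h2
  rw [← restrict_Ioo_eq_restrict_Ioc]
  filter_upwards [ae_restrict_mem measurableSet_Ioo] with t ht
  have hd : HasDerivAt (fun s => (T - s) / T * (X - c * (T / 4) * timeIntegral Y s ω))
      (optimalRate Y T X c t ω) t := by
    have h := (((hasDerivAt_id t).const_sub T).div_const T).mul
      (((hasDerivAt_timeIntegral h2 ht).const_mul (c * (T / 4))).const_sub X)
    refine h.congr_deriv ?_
    simp only [optimalRate, id]
    field_simp
    ring
  refine (hd.congr_of_eventuallyEq ?_).deriv.symm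
  filter_upwards [Ioo_mem_nhds ht.1 ht.2] with s hs
  exact h1 s ⟨hs.1.le, hs.2.le⟩

variable [IsProbabilityMeasure P]

/-- A square integrable rate gives a finite criterion, equal to the expected cost of the rate. -/
lemma IsAdmissibleStrategy.executionCriterion_eq_rateCost (hx : IsAdmissibleStrategy P 𝓕 T X x)
    (hT : 0 ≤ T) (hY : IsL2Martingale P 𝓕 T y₀ Y)
    (hSY : ∀ᵐ ω ∂P, ∀ t ∈ Set.Icc 0 T, Y t ω = S t.toNNReal ω - K)
    (hv : IsRateOf P T x v) (c : ℝ)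
    (hL2 : MemLp (Function.uncurry v) 2 ((volume.restrict (Set.Ioc 0 T)).prod P)) :
    executionCriterion P S K T c x = (rateCost P Y T c v : EReal) := by
  have hI := memLp_timeIntegral hY.measurable hY.memLp_prod
  have hint : Integrable
      (fun p : ℝ × Ω => v p.1 p.2 ^ 2 - c * (timeIntegral Y p.1 p.2 * v p.1 p.2))
      ((volume.restrict (Set.Ioc 0 T)).prod P) :=
    hL2.integrable_sq.sub ((hI.integrable_mul hL2).const_mul c)
  unfold executionCriterion
  rw [extendedExpectation_congr (g := fun ω => ((∫ t in Set.Ioc 0 T,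
    (v t ω ^ 2 - c * (timeIntegral Y t ω * v t ω)) : ℝ) : EReal)) ?_,
    extendedExpectation_coe hint.integral_prod_right]
  · unfold rateCost
    rw [integral_prod_symm _ hint]
  · filter_upwards [hx.pathCost_ae_eq hT hY hSY hv c, ae_memLp_two_of_memLp_prod_right hL2,
      ae_memLp_two_of_memLp_prod_right hI] with ω h1 h2 h3
    have hvI : Integrable (fun t => timeIntegral Y t ω * v t ω)
      (volume.restrict (Set.Ioc 0 T)) := h3.integrable_mul h2
    rw [h1, ← ofReal_integral_eq_lintegral_ofReal h2.integrable_sq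
      (ae_of_all _ fun t => sq_nonneg _), EReal.coe_ennreal_ofReal,
      max_eq_left (integral_nonneg fun t => sq_nonneg _), ← EReal.coe_add,
      integral_sub h2.integrable_sq (hvI.const_mul c), integral_const_mul, sub_eq_add_neg]

/-- A rate which is not square integrable on `[0, T] × Ω` makes the criterion infinite, even if
almost every path has a square integrable derivative. -/
lemma IsAdmissibleStrategy.executionCriterion_eq_top (hx : IsAdmissibleStrategy P 𝓕 T X x)
    (hT : 0 ≤ T) (hY : IsL2Martingale P 𝓕 T y₀ Y)
    (hSY : ∀ᵐ ω ∂P, ∀ t ∈ Set.Icc 0 T, Y t ω = S t.toNNReal ω - K)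
    (hv : IsRateOf P T x v) (c : ℝ) (hm : Measurable (Function.uncurry v))
    (hL2 : ¬ MemLp (Function.uncurry v) 2 ((volume.restrict (Set.Ioc 0 T)).prod P)) :
    executionCriterion P S K T c x = ⊤ := by
  have hI := memLp_timeIntegral hY.measurable hY.memLp_prod
  have hsq : Measurable fun p : ℝ × Ω => ENNReal.ofReal (v p.1 p.2 ^ 2) :=
    (hm.pow_const 2).ennreal_ofReal
  have hG : Integrable (fun ω => ∫ t in Set.Ioc 0 T, c ^ 2 / 2 * timeIntegral Y t ω ^ 2) P :=
    (hI.integrable_sq.const_mul (c ^ 2 / 2)).integral_prod_right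
  unfold executionCriterion
  rw [extendedExpectation_congr (hx.pathCost_ae_eq hT hY hSY hv c)]
  refine extendedExpectation_eq_top hG ?_ ?_ ?_
  · rw [← lintegral_prod_symm _ hsq.aemeasurable]
    rw [memLp_two_iff_integrable_sq hm.aestronglyMeasurable] at hL2
    by_contra hne
    refine hL2 ⟨(hm.pow_const 2).aestronglyMeasurable, ?_⟩
    rw [hasFiniteIntegral_iff_ofReal (ae_of_all _ fun p => sq_nonneg _)]
    exact lt_top_iff_ne_top.2 hne
  · exact (hsq.comp measurable_swap).lintegral_prod_right'.aemeasurable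
  · filter_upwards [ae_memLp_two_of_memLp_prod_right hI] with ω h3 hfin
    have hmω : Measurable fun t => v t ω := hm.comp (measurable_id.prodMk measurable_const)
    have h2i : Integrable (fun t => v t ω ^ 2) (volume.restrict (Set.Ioc 0 T)) := by
      refine ⟨(hmω.pow_const 2).aestronglyMeasurable, ?_⟩
      rw [hasFiniteIntegral_iff_ofReal (ae_of_all _ fun p => sq_nonneg _)]
      exact lt_top_iff_ne_top.2 hfin
    have hA : (∫⁻ t in Set.Ioc 0 T, ENNReal.ofReal (v t ω ^ 2)).toReal =
        ∫ t in Set.Ioc 0 T, v t ω ^ 2 :=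
      (integral_eq_lintegral_of_nonneg_ae (ae_of_all _ fun t => sq_nonneg _)
        h2i.aestronglyMeasurable).symm
    rw [hA, abs_neg, ← integral_const_mul, ← integral_div,
      ← integral_add (h2i.div_const 2) (h3.integrable_sq.const_mul (c ^ 2 / 2))]
    refine abs_integral_le_integral_abs.trans ?_
    refine integral_mono_of_nonneg (ae_of_all _ fun t => abs_nonneg _)
      ((h2i.div_const 2).add (h3.integrable_sq.const_mul (c ^ 2 / 2))) (ae_of_all _ fun t => ?_)
    -- Young's inequality.
    simp only
    rw [abs_le]
    constructor <;>
      nlinarith [sq_nonneg (v t ω - c * timeIntegral Y t ω),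
        sq_nonneg (v t ω + c * timeIntegral Y t ω)]

/-- The optimal execution problem for an arbitrary square integrable continuous martingale. -/
theorem IsL2Martingale.optimal_execution (hY : IsL2Martingale P 𝓕 T y₀ Y) (hT : 0 < T)
    (hSY : ∀ᵐ ω ∂P, ∀ t ∈ Set.Icc 0 T, Y t ω = S t.toNNReal ω - K) (X c : ℝ) :
    IsAdmissibleStrategy P 𝓕 T X (optimalStrategy S K T X c) ∧
    (∀ x, IsAdmissibleStrategy P 𝓕 T X x → executionCriterion P S K T c
      (optimalStrategy S K T X c) ≤ executionCriterion P S K T c x) ∧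
    (∀ x, IsAdmissibleStrategy P 𝓕 T X x →
      (∀ y, IsAdmissibleStrategy P 𝓕 T X y →
        executionCriterion P S K T c x ≤ executionCriterion P S K T c y) →
      ∀ᵐ ω ∂P, ∀ t ∈ Set.Icc 0 T, x t ω = optimalStrategy S K T X c t ω) ∧
    executionCriterion P S K T c (optimalStrategy S K T X c) =
      ((X ^ 2 / T + c * T * X * y₀ / 2 -
        c ^ 2 / 16 * ∫ t in (0 : ℝ)..T, (T - t) ^ 2 * ∫ ω, Y t ω ^ 2 ∂P : ℝ) : EReal) := by
  have hxs := hY.isAdmissibleStrategy_optimalStrategy hT hSY X c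
  have hrate := hY.isRateOf_optimalStrategy hT hSY X c
  have ho := hY.isAdmissibleRate_optimalRate hT X c
  have hJ := hxs.executionCriterion_eq_rateCost hT.le hY hSY hrate c ho.memLp
  refine ⟨hxs, fun x hx => ?_, fun x hx hmin => ?_, ?_⟩
  · obtain ⟨v, hvm, hva, hv⟩ :=
      exists_measurable_adapted_deriv hx.aestronglyMeasurable hx.absolutelyContinuous hT.le
    by_cases hL2 : MemLp (Function.uncurry v) 2 ((volume.restrict (Set.Ioc 0 T)).prod P)
    · rw [hJ, hx.executionCriterion_eq_rateCost hT.le hY hSY hv c hL2, EReal.coe_le_coe_iff,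
        hY.rateCost_eq_add hT c (hx.isAdmissibleRate hT.le hv hL2 hva)]
      exact le_add_of_nonneg_right (integral_nonneg fun p => sq_nonneg _)
    · rw [hx.executionCriterion_eq_top hT.le hY hSY hv c hvm hL2]
      exact le_top
  · obtain ⟨v, hvm, hva, hv⟩ :=
      exists_measurable_adapted_deriv hx.aestronglyMeasurable hx.absolutelyContinuous hT.le
    have hle := hmin _ hxs
    have hL2 : MemLp (Function.uncurry v) 2 ((volume.restrict (Set.Ioc 0 T)).prod P) := by
      by_contra hL2
      rw [hx.executionCriterion_eq_top hT.le hY hSY hv c hvm hL2, hJ, top_le_iff] at hle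
      exact EReal.coe_ne_top _ hle
    rw [hJ, hx.executionCriterion_eq_rateCost hT.le hY hSY hv c hL2, EReal.coe_le_coe_iff,
      hY.rateCost_eq_add hT c (hx.isAdmissibleRate hT.le hv hL2 hva)] at hle
    have hint : Integrable (fun p : ℝ × Ω => (v p.1 p.2 - optimalRate Y T X c p.1 p.2) ^ 2)
      ((volume.restrict (Set.Ioc 0 T)).prod P) := (hL2.sub ho.memLp).integrable_sq
    have hzero : ∫ p, (v p.1 p.2 - optimalRate Y T X c p.1 p.2) ^ 2
        ∂((volume.restrict (Set.Ioc 0 T)).prod P) = 0 :=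
      le_antisymm (by linarith) (integral_nonneg fun p => sq_nonneg _)
    rw [integral_prod_symm _ hint, integral_eq_zero_iff_of_nonneg
      (fun ω => integral_nonneg fun t => sq_nonneg _) hint.integral_prod_right] at hzero
    filter_upwards [hzero, hint.prod_left_ae, hx.ae_eq_add_integral hv,
      hxs.ae_eq_add_integral hrate] with ω h1 h2 h3 h4 t ht
    have h5 := (integral_eq_zero_iff_of_nonneg (fun t => sq_nonneg _) h2).1 h1
    rw [h3 t ht, h4 t ht]
    congr 1
    refine integral_congr_ae (ae_restrict_of_ae_restrict_of_subset
      (Set.Ioc_subset_Ioc_right ht.2) ?_)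
    filter_upwards [h5] with u hu
    exact sub_eq_zero.1 (pow_eq_zero_iff two_ne_zero |>.1 hu)
  · rw [hJ, hY.rateCost_optimalRate hT X c]

end Strategy

/-! ### Displaced diffusions are square integrable martingales -/

lemma integrable_exp_of_hasLaw_gaussianReal {Ω : Type*} [MeasurableSpace Ω] {P : Measure Ω}
    {G : Ω → ℝ} {v : ℝ≥0} (hG : HasLaw G (gaussianReal 0 v) P) (a b : ℝ) :
    Integrable (fun ω => Real.exp (a * G ω + b)) P := by
  have h : Integrable (fun x : ℝ => Real.exp (a * x)) (P.map G) := by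
    rw [hG.map_eq]
    exact integrable_exp_mul_gaussianReal a
  simp_rw [Real.exp_add]
  exact (h.comp_aemeasurable hG.aemeasurable).mul_const _

lemma integral_exp_of_hasLaw_gaussianReal {Ω : Type*} [MeasurableSpace Ω] {P : Measure Ω}
    {G : Ω → ℝ} {v : ℝ≥0} (hG : HasLaw G (gaussianReal 0 v) P) (a b : ℝ) :
    ∫ ω, Real.exp (a * G ω + b) ∂P = Real.exp (v * a ^ 2 / 2 + b) := by
  have h := mgf_gaussianReal hG.map_eq a
  rw [mgf, zero_mul, zero_add] at h
  simp_rw [Real.exp_add, integral_mul_const, h]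

lemma IsGeometricBrownian.ae_continuous {Ω : Type*} [MeasurableSpace Ω] {P : Measure Ω}
    {Y : ℝ≥0 → Ω → ℝ} {σ y₀ : ℝ} (h : IsGeometricBrownian Y σ y₀ P) :
    ∀ᵐ ω ∂P, Continuous fun t => Y t ω := by
  obtain ⟨W, hW, hY⟩ := h
  filter_upwards [hW.cont, hY] with ω h1 h2
  have : (fun t => Y t ω) =
      fun t : ℝ≥0 => y₀ * Real.exp (σ * W t ω - σ ^ 2 * (t : ℝ) / 2) := funext h2
  rw [this]
  fun_prop

lemma IsGeometricBrownian.integrable_sq_and_moments {Ω : Type*} [MeasurableSpace Ω]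
    {P : Measure Ω} {Y : ℝ≥0 → Ω → ℝ} {σ y₀ : ℝ} (h : IsGeometricBrownian Y σ y₀ P) (t : ℝ≥0) :
    Integrable (fun ω => Y t ω ^ 2) P ∧ ∫ ω, Y t ω ∂P = y₀ ∧
      ∫ ω, Y t ω ^ 2 ∂P = y₀ ^ 2 * Real.exp (σ ^ 2 * t) := by
  obtain ⟨W, hW, hY⟩ := h
  have e1 : (fun ω => Y t ω) =ᵐ[P]
      fun ω => y₀ * Real.exp (σ * W t ω + -(σ ^ 2 * (t : ℝ) / 2)) := by
    filter_upwards [hY] with ω hω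
    rw [hω t, sub_eq_add_neg]
  have e2 : (fun ω => Y t ω ^ 2) =ᵐ[P]
      fun ω => y₀ ^ 2 * Real.exp (2 * σ * W t ω + -(σ ^ 2 * (t : ℝ))) := by
    filter_upwards [e1] with ω hω
    rw [hω, mul_pow, ← Real.exp_nat_mul]
    congr 2
    push_cast
    ring
  have hl := hW.hasLaw_eval t
  refine ⟨?_, ?_, ?_⟩
  · exact ((integrable_exp_of_hasLaw_gaussianReal hl _ _).const_mul _).congr e2.symm
  · rw [integral_congr_ae e1, integral_const_mul, integral_exp_of_hasLaw_gaussianReal hl]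
    rw [show (t : ℝ) * σ ^ 2 / 2 + -(σ ^ 2 * (t : ℝ) / 2) = 0 by ring, Real.exp_zero, mul_one]
  · rw [integral_congr_ae e2, integral_const_mul, integral_exp_of_hasLaw_gaussianReal hl]
    congr 2
    ring

/-- Every random variable in the past of `S` at time `t` is independent of the later increments of
the driving Brownian motion, since `S` is almost surely a function of it. -/
lemma indepFun_natural_increment {Ω : Type*} [mΩ : MeasurableSpace Ω] {P : Measure Ω}
    {S : ℝ≥0 → Ω → ℝ} (hS : ∀ t, Measurable (S t)) {W : ℝ≥0 → Ω → ℝ} (hW : IsBrownianReal W P)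
    {g : ℝ≥0 → ℝ → ℝ} (hg : ∀ t, Measurable (g t))
    (hSW : ∀ᵐ ω ∂P, ∀ t, S t ω = g t (W t ω)) {t u : ℝ≥0} (htu : t ≤ u) {ψ : Ω → ℝ}
    (hψ : Measurable[Filtration.natural S (fun t => (hS t).stronglyMeasurable) t] ψ)
    {f : ℝ → ℝ} (hf : Measurable f) :
    IndepFun ψ (fun ω => f (W u ω - W t ω)) P := by
  have h1 : IndepFun (fun ω (j : Set.Iic t) => W j ω) (fun ω s => W (t + s) ω - W t ω) P :=
    (hW.indepFun_shift t).symm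
  have hφ : Measurable fun (x : Set.Iic t → ℝ) (j : Set.Iic t) => g j (x j) :=
    measurable_pi_lambda _ fun j => (hg j).comp (measurable_pi_apply j)
  have hφ' : Measurable fun x : ℝ≥0 → ℝ => f (x (u - t)) := hf.comp (measurable_pi_apply _)
  have h2 := h1.comp hφ hφ'
  have h3 : IndepFun (fun ω (j : Set.Iic t) => S j ω) (fun ω => f (W u ω - W t ω)) P := by
    refine h2.congr ?_ (ae_of_all _ fun ω => ?_)
    · filter_upwards [hSW] with ω hω
      funext j
      exact (hω j).symm
    · simp only [Function.comp, add_tsub_cancel_of_le htu]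
  rw [IndepFun_iff_Indep] at h3 ⊢
  refine indep_of_indep_of_le_left h3 ?_
  rw [← Filtration.natural_eq_comap S (fun t => (hS t).stronglyMeasurable)]
  exact hψ.comap_le

/-- The martingale property of a displaced diffusion with respect to its own filtration: the ratio
`Z` of the values at the two times is independent of the past and has expectation one. -/
lemma IsDisplacedDiffusion.integral_mul_eq {Ω : Type*} [mΩ : MeasurableSpace Ω] {P : Measure Ω}
    {S : ℝ≥0 → Ω → ℝ} (hS : ∀ t, Measurable (S t)) {σ K S₀ : ℝ}
    (h : IsDisplacedDiffusion S σ K S₀ P) {t u : ℝ≥0} (htu : t ≤ u) {φ : Ω → ℝ}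
    (hφ : AEStronglyMeasurable[Filtration.natural S (fun t => (hS t).stronglyMeasurable) t] φ P) :
    ∫ ω, φ ω * (S u ω - K) ∂P = ∫ ω, φ ω * (S t ω - K) ∂P := by
  obtain ⟨W, hW, hY⟩ := h
  set 𝓕 := Filtration.natural S (fun t => (hS t).stronglyMeasurable)
  set Z : Ω → ℝ := fun ω => Real.exp (σ * (W u ω - W t ω) + -(σ ^ 2 * ((u : ℝ) - t) / 2)) with hZ
  have hSt : Measurable[𝓕 t] (S t) :=
    (Filtration.stronglyAdapted_natural (fun t => (hS t).stronglyMeasurable) t).measurable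
  have hψ : Measurable[𝓕 t] fun ω => hφ.mk φ ω * (S t ω - K) :=
    hφ.stronglyMeasurable_mk.measurable.mul (hSt.sub_const K)
  have hψm : Measurable fun ω => hφ.mk φ ω * (S t ω - K) := hψ.mono (𝓕.le t) le_rfl
  have hind : IndepFun (fun ω => hφ.mk φ ω * (S t ω - K)) Z P :=
    indepFun_natural_increment hS hW
      (g := fun t w => (S₀ - K) * Real.exp (σ * w - σ ^ 2 * (t : ℝ) / 2) + K)
      (fun t => by fun_prop)
      (by filter_upwards [hY] with ω hω s; have := hω s; linarith)
      htu hψ (f := fun x => Real.exp (σ * x + -(σ ^ 2 * ((u : ℝ) - t) / 2))) (by fun_prop)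
  have hlaw := hW.hasLaw_sub u t
  have hZm : AEStronglyMeasurable Z P :=
    (integrable_exp_of_hasLaw_gaussianReal hlaw σ _).aestronglyMeasurable
  have hZ1 : ∫ ω, Z ω ∂P = 1 := by
    have := integral_exp_of_hasLaw_gaussianReal hlaw σ (-(σ ^ 2 * ((u : ℝ) - t) / 2))
    refine this.trans ?_
    have hd : ((nndist u.1 t.1 : ℝ≥0) : ℝ) = (u : ℝ) - t := by
      rw [coe_nndist, Real.dist_eq]
      exact abs_of_nonneg (sub_nonneg.2 (NNReal.coe_le_coe.2 htu))
    rw [hd, show ((u : ℝ) - t) * σ ^ 2 / 2 + -(σ ^ 2 * ((u : ℝ) - t) / 2) = 0 by ring,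
      Real.exp_zero]
  have e1 : (fun ω => φ ω * (S u ω - K)) =ᵐ[P] fun ω => hφ.mk φ ω * (S t ω - K) * Z ω := by
    filter_upwards [hY, hφ.ae_eq_mk] with ω h1 h2
    rw [h1 u, h1 t, h2, hZ, mul_assoc, mul_assoc, ← Real.exp_add]
    congr 3
    ring
  have e2 : (fun ω => φ ω * (S t ω - K)) =ᵐ[P] fun ω => hφ.mk φ ω * (S t ω - K) := by
    filter_upwards [hφ.ae_eq_mk] with ω h2
    rw [h2]
  rw [integral_congr_ae e1, integral_congr_ae e2,
    hind.integral_fun_mul_eq_mul_integral hψm.aestronglyMeasurable hZm, hZ1, mul_one]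

/-- A displaced diffusion, recentred at its shift, has a jointly measurable version which is
a square integrable martingale with the second moment of a geometric Brownian motion. -/
lemma IsDisplacedDiffusion.exists_isL2Martingale {Ω : Type*} [mΩ : MeasurableSpace Ω]
    {P : Measure Ω} [IsProbabilityMeasure P] {S : ℝ≥0 → Ω → ℝ} (hS : ∀ t, Measurable (S t))
    {σ K S₀ : ℝ} (h : IsDisplacedDiffusion S σ K S₀ P) (T : ℝ) :
    ∃ Y : ℝ → Ω → ℝ,
      IsL2Martingale P (Filtration.natural S (fun t => (hS t).stronglyMeasurable)) T (S₀ - K) Y ∧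
      (∀ᵐ ω ∂P, ∀ t ∈ Set.Icc 0 T, Y t ω = S t.toNNReal ω - K) ∧
      ∀ t ∈ Set.Icc 0 T, ∫ ω, Y t ω ^ 2 ∂P = (S₀ - K) ^ 2 * Real.exp (σ ^ 2 * t) := by
  have hgb : IsGeometricBrownian (fun t ω => S t ω - K) σ (S₀ - K) P := h
  have hcont : ∀ᵐ ω ∂P, Continuous fun t : ℝ => S t.toNNReal ω - K := by
    filter_upwards [hgb.ae_continuous] with ω hω
    exact hω.comp continuous_real_toNNReal
  obtain ⟨Y, hYm, hYS⟩ := exists_jointly_measurable_version (P := P) (T := T)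
    (z := fun t ω => S t.toNNReal ω - K) mΩ
    (fun t _ => ((hS _).sub_const K).aestronglyMeasurable)
    (hcont.mono fun ω hω => hω.continuousOn)
  have hae : ∀ t ∈ Set.Icc 0 T, Y t =ᵐ[P] fun ω => S t.toNNReal ω - K :=
    fun t ht => hYS.mono fun ω hω => hω t ht
  have hYt : ∀ t, Measurable (Y t) := fun t => hYm.comp (measurable_const.prodMk measurable_id)
  have hsq : ∀ t ∈ Set.Icc 0 T, Integrable (fun ω => Y t ω ^ 2) P := fun t ht =>
    (hgb.integrable_sq_and_moments t.toNNReal).1.congr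
      ((hae t ht).mono fun ω hω => by simp only [hω])
  have hmom : ∀ t ∈ Set.Icc 0 T,
      ∫ ω, Y t ω ^ 2 ∂P = (S₀ - K) ^ 2 * Real.exp (σ ^ 2 * t) := by
    intro t ht
    have h1 := (hgb.integrable_sq_and_moments t.toNNReal).2.2
    rw [Real.coe_toNNReal t ht.1] at h1
    rw [← h1]
    exact integral_congr_ae ((hae t ht).mono fun ω hω => by simp only [hω])
  refine ⟨Y, ⟨hYm, ?_, ?_, ?_, ?_, ?_, ?_⟩, hYS, hmom⟩
  · filter_upwards [hcont, hYS] with ω h1 h2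
    exact h1.continuousOn.congr h2
  · intro t ht
    have hSt := (Filtration.stronglyAdapted_natural
      (fun t => (hS t).stronglyMeasurable) t.toNNReal).measurable
    exact (hSt.sub_const K).stronglyMeasurable.aestronglyMeasurable.congr (hae t ht).symm
  · rw [memLp_two_iff_integrable_sq hYm.aestronglyMeasurable,
      integrable_prod_iff (hYm.pow_const 2).aestronglyMeasurable]
    constructor
    · filter_upwards [ae_restrict_mem measurableSet_Ioc] with t ht
      exact hsq t ⟨ht.1.le, ht.2⟩
    · have hc : IntegrableOn (fun t => (S₀ - K) ^ 2 * Real.exp (σ ^ 2 * t)) (Set.Ioc 0 T) :=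
        (by fun_prop : Continuous fun t => (S₀ - K) ^ 2 * Real.exp (σ ^ 2 * t)).integrableOn_Ioc
      refine Integrable.congr hc ?_
      filter_upwards [ae_restrict_mem measurableSet_Ioc] with t ht
      rw [← hmom t ⟨ht.1.le, ht.2⟩]
      refine integral_congr_ae (ae_of_all _ fun ω => ?_)
      simp [Function.uncurry]
  · intro t ht
    exact (memLp_two_iff_integrable_sq (hYt t).aestronglyMeasurable).2 (hsq t ht)
  · intro t ht
    rw [integral_congr_ae (hae t ht)]
    exact (hgb.integrable_sq_and_moments t.toNNReal).2.1
  · intro t u ht htu huT φ hφ _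
    rw [integral_congr_ae ((hae u ⟨ht.trans htu, huT⟩).mono fun ω hω => by
        simp only [hω] : (fun ω => φ ω * Y u ω) =ᵐ[P] fun ω => φ ω * (S u.toNNReal ω - K)),
      integral_congr_ae ((hae t ⟨ht, htu.trans huT⟩).mono fun ω hω => by
        simp only [hω] : (fun ω => φ ω * Y t ω) =ᵐ[P] fun ω => φ ω * (S t.toNNReal ω - K))]
    exact h.integral_mul_eq hS (Real.toNNReal_le_toNNReal htu) hφ

/-! ### The optimal strategy for a displaced diffusion -/

lemma integral_sub_sq_mul_exp {a : ℝ} (ha : a ≠ 0) (T : ℝ) :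
    ∫ t in (0 : ℝ)..T, (T - t) ^ 2 * Real.exp (a * t) =
      2 / a ^ 3 * (Real.exp (a * T) - 1 - a * T - a ^ 2 * T ^ 2 / 2) := by
  -- The antiderivative comes from integrating by parts twice.
  have hd : ∀ t : ℝ, HasDerivAt
      (fun t => Real.exp (a * t) * ((T - t) ^ 2 / a + 2 * (T - t) / a ^ 2 + 2 / a ^ 3))
      ((T - t) ^ 2 * Real.exp (a * t)) t := by
    intro t
    have h1 : HasDerivAt (fun t : ℝ => T - t) (-1) t := by
      simpa using (hasDerivAt_id t).const_sub T
    have h2 : HasDerivAt (fun t : ℝ => Real.exp (a * t)) (Real.exp (a * t) * a) t := by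
      simpa using ((hasDerivAt_id t).const_mul a).exp
    have h3 := h2.mul ((((h1.pow 2).div_const a).add ((h1.const_mul 2).div_const (a ^ 2))).add_const
      (2 / a ^ 3))
    refine h3.congr_deriv ?_
    simp only [Pi.add_apply, Pi.pow_apply]
    field_simp
    push_cast
    ring
  rw [intervalIntegral.integral_eq_sub_of_hasDerivAt (fun t _ => hd t)
    ((by fun_prop : Continuous fun t => (T - t) ^ 2 * Real.exp (a * t)).intervalIntegrable _ _)]
  simp only [sub_self, mul_zero, Real.exp_zero, sub_zero]
  field_simp
  ring

theorem mainTheorem1 {Ω : Type*} [mΩ : MeasurableSpace Ω] (P : Measure Ω) [IsProbabilityMeasure P]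
    (S : ℝ≥0 → Ω → ℝ) (hS : ∀ t, Measurable (S t)) (σ K S₀ T X L lam : ℝ)
    (hσ : 0 < σ) (hT : 0 < T) (hDD : IsDisplacedDiffusion S σ K S₀ P) :
    let 𝓕 : Filtration ℝ≥0 mΩ := Filtration.natural S (fun t => (hS t).stronglyMeasurable)
    let J : (ℝ → Ω → ℝ) → EReal := executionCriterion P S K T (L * lam)
    let xs : ℝ → Ω → ℝ := optimalStrategy S K T X (L * lam)
    -- the strategy is admissible and attains the infimum over all admissible strategies
    IsAdmissibleStrategy P 𝓕 T X xs ∧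
    (∀ x, IsAdmissibleStrategy P 𝓕 T X x → J xs ≤ J x) ∧
    -- any admissible strategy attaining the infimum is indistinguishable from it
    (∀ x, IsAdmissibleStrategy P 𝓕 T X x →
      (∀ y, IsAdmissibleStrategy P 𝓕 T X y → J x ≤ J y) →
      ∀ᵐ ω ∂P, ∀ t ∈ Set.Icc 0 T, x t ω = xs t ω) ∧
    -- the optimal value
    J xs = ((X ^ 2 / T + L * lam * T * X * (S₀ - K) / 2
      - (L * lam) ^ 2 / (8 * σ ^ 6) * (S₀ - K) ^ 2
        * (Real.exp (σ ^ 2 * T) - 1 - σ ^ 2 * T - σ ^ 4 * T ^ 2 / 2) : ℝ) : EReal) := by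
  intro 𝓕 J xs
  obtain ⟨Y, hY, hSY, hmom⟩ := hDD.exists_isL2Martingale hS T
  obtain ⟨h1, h2, h3, h4⟩ := hY.optimal_execution hT hSY X (L * lam)
  refine ⟨h1, h2, h3, h4.trans ?_⟩
  have hint : ∫ t in (0 : ℝ)..T, (T - t) ^ 2 * ∫ ω, Y t ω ^ 2 ∂P =
      (S₀ - K) ^ 2 * ∫ t in (0 : ℝ)..T, (T - t) ^ 2 * Real.exp (σ ^ 2 * t) := by
    rw [← intervalIntegral.integral_const_mul]
    refine intervalIntegral.integral_congr fun t ht => ?_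
    rw [Set.uIcc_of_le hT.le] at ht
    simp only [hmom t ht]
    ring
  rw [hint, integral_sub_sq_mul_exp (by positivity)]
  congr 1
  field_simp
  ring
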